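/- **Corollary (Boundedness of the $L^p(S^2)$-norms of Mexican needlets).** Let $S^2\subset\mathbb R^3$ be the unit sphere with its surface measure (total mass $4\pi$). Fix $B>1$, an integer $s\ge 0$ and constants $c_B,c_B'>0$. Let $f_s(x)=x^{2s}e^{-x^2}$ (with $0^0=1$), let $P_l$ be the Legendre polynomial of degree $l$, and for $j\in\mathbb Z$ put $$K_{j;s}(x,y)=\sum_{l\ge 0} f_s\!\left(\frac{l}{B^j}\right)\frac{2l+1}{4\pi}\,P_l(\langle x,y\rangle),\qquad x,y\in S^2 .$$ A *partition at level $j$* is a finite family $E_{j1},\dots,E_{jN_j}$ of pairwise disjoint measurable sets covering $S^2$, with points $\xi_{jk}\in E_{jk}$, such that for every $k$ the geodesic diameter of $E_{jk}$ is at most $c_B B^{-j}$ and its area $\lambda_{jk}$ satisfies $\lambda_{jk}\ge c_B' B^{-2j}$. The associated Mexican needlets are $\psi_{jk;s}(x)=\sqrt{\lambda_{jk}}\,K_{j;s}(x,\xi_{jk})$. Then the series defining $K_{j;s}$ converges absolutely at every point, $\psi_{jk;s}\in L^p(S^2)$ for all $p\in[1,\infty]$, and: 1. for every $p\in[1,\infty)$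 there are constants $0<c_p\le C_p<\infty$, depending only on $p,s,B,c_B,c_B'$, such that $$c_p\,B^{2j\left(\frac12-\frac1p\right)}\le\|\psi_{jk;s}\|_{L^p(S^2)}\le C_p\,B^{2j\left(\frac12-\frac1p\right)}$$ for every $j\in\mathbb Z$, every partition at level $j$ and every $k$; 2. there are constants $0<c_\infty\le C_\infty<\infty$, depending only on $s,B,c_B,c_B'$, such that $$c_\infty B^j\le\|\psi_{jk;s}\|_{L^\infty(S^2)}\le C_\infty B^j$$ for every $j\in\mathbb Z$, every partition at level $j$ and every $k$. -/

import Mathlib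

open MeasureTheory
open scoped ENNReal

noncomputable section

namespace MexicanNeedlet

/-- The unit sphere `S²` of `ℝ³`. -/
abbrev S2 : Type := Metric.sphere (0 : EuclideanSpace ℝ (Fin 3)) 1

/-- The (unnormalised, total mass `4π`) surface measure of `S²`. -/
def area : Measure S2 := (volume : Measure (EuclideanSpace ℝ (Fin 3))).toSphere

/-- The geodesic distance on `S²`. -/
def geodesicDist (x y : S2) : ℝ :=
  Real.arccos (inner ℝ (x : EuclideanSpace ℝ (Fin 3)) (y : EuclideanSpace ℝ (Fin 3)))

/-- The Legendre polynomial of degree `l`, by the Rodrigues formula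
`P_l(u) = 1 / (2 ^ l l!) * d^l/du^l (u ^ 2 - 1) ^ l`. -/
def legendreP (l : ℕ) : Polynomial ℝ :=
  Polynomial.C (1 / ((2 : ℝ) ^ l * (l.factorial : ℝ))) *
    (Polynomial.derivative^[l] ((Polynomial.X ^ 2 - 1) ^ l))

/-- The weight function `f_s(x) = x ^ (2 s) * exp (- x ^ 2)`. -/
def weight (s : ℕ) (x : ℝ) : ℝ := x ^ (2 * s) * Real.exp (-x ^ 2)

/-- The `l`-th term `f_s(l / B ^ j) * (2 l + 1) / (4 π) * P_l(⟨x, y⟩)` of the kernel series. -/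
def kernelTerm (B : ℝ) (j : ℤ) (s : ℕ) (x y : S2) (l : ℕ) : ℝ :=
  weight s ((l : ℝ) / B ^ j) * ((2 * (l : ℝ) + 1) / (4 * Real.pi)) *
    (legendreP l).eval (inner ℝ (x : EuclideanSpace ℝ (Fin 3)) (y : EuclideanSpace ℝ (Fin 3)))

/-- The kernel `K_{j;s}(x, y)`. -/
def kernel (B : ℝ) (j : ℤ) (s : ℕ) (x y : S2) : ℝ := ∑' l : ℕ, kernelTerm B j s x y l

/-- A partition of the sphere at resolution level `j` into finitely many measurable regions `E k`,
of geodesic diameter at most `cB * B ^ (-j)` and of area at least `cB' * B ^ (-2 j)`,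
each indexed by a point `ξ k` of it. -/
structure IsPartition (B cB cB' : ℝ) (j : ℤ) {N : ℕ} (E : Fin N → Set S2) (ξ : Fin N → S2) :
    Prop where
  measurable : ∀ k, MeasurableSet (E k)
  cover : ⋃ k, E k = Set.univ
  disjoint : ∀ k₁ k₂, k₁ ≠ k₂ → E k₁ ∩ E k₂ = ∅
  diam_le : ∀ k, ∀ x ∈ E k, ∀ y ∈ E k, geodesicDist x y ≤ cB * B ^ (-j)
  point_mem : ∀ k, ξ k ∈ E k
  le_area : ∀ k, cB' * B ^ (-2 * j) ≤ area.real (E k)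

/-- The Mexican needlet `ψ_{jk;s}(x) = √λ_{jk} * K_{j;s}(x, ξ_{jk})`, where `λ_{jk}` is the area
of the region `E_{jk}`. -/
def needlet (B : ℝ) (j : ℤ) (s : ℕ) {N : ℕ} (E : Fin N → Set S2) (ξ : Fin N → S2) (k : Fin N)
    (x : S2) : ℝ :=
  Real.sqrt (area.real (E k)) * kernel B j s x (ξ k)

end MexicanNeedlet

end

/-!
Write `t = B ^ (-j)` and `d = |x - y|` for the chord. Everything rests on the localisation estimate
`|K(x, y)| ≤ C t / max(t, d) ^ 3`, uniform for bounded `t`, and on a matching lower bound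
`K(x, y) ≥ c t ^ (-2)` for `d ≤ δ t`.

For the upper bound (`exists_kernelSeries_le`), `f_s(l t)` is written as a Fourier integral of a
Gaussian times a Hermite polynomial, taken along the line `Im z = 1` instead of the real line. The
frequency `l` then enters as `r ^ l` with `r = exp (2 i t (w + i))`, of modulus `exp (-2 t) < 1`, so
that the kernel is a superposition of Poisson sums `∑ (2 l + 1) P_l(x) r ^ l` with complex `r`. With
`D = 1 - 2 x r + r ^ 2` and `G = ∑ P_l(x) r ^ l` such a sum is `(1 - r ^ 2) G / D`, and
`G ^ 2 D = 1`. Its absolute value is thus `|1 - r ^ 2| |D| ^ (-3 / 2)`, where `|1 - r ^ 2|` is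
`O(t (1 + |w|))` and `|D|` is at least of order `(max(t, d) / (1 + |w|)) ^ 2`; the powers
of `1 + |w|` are absorbed by the Gaussian.

The facts about Legendre polynomials all come from the three-term recurrence, read as a differential
equation for the generating function. It gives `G ^ 2 D = 1` as an identity of formal power series,
and the factorisation of `G` at the roots `exp (± i θ)` of `D` expresses `P_l(cos θ)` as a convex
combination of the numbers `exp (i (m - n) θ)` with `m + n = l`. Hence `|P_l| ≤ 1` and
`1 - P_l(x) ≤ l ^ 2 (1 - x)`.

For the lower bound (`exists_le_kernel`), the diagonal value of the kernel is at least of order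
`t ^ (-2)` by counting terms, while `1 - P_l(x) ≤ l ^ 2 (1 - x)` bounds the drop from the diagonal
by `d ^ 2 t ^ (-2)` times the diagonal value of the kernel with `s + 1`, that is by
`O(d ^ 2 t ^ (-4))`.

Finally, caps of radius `ρ` have area of order `ρ ^ 2`, which yields `‖K‖_1 = O(1)` and, with
`|K| ≤ C t ^ (-2)`, the bound for `‖K‖_p`. The regions of a partition have area of order `t ^ 2`; as
the area of the sphere is finite, this also bounds `t` for the levels at which partitions exist.
-/

noncomputable section

namespace MexicanNeedlet

/-! ### Legendre polynomials and their generating function -/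

open Polynomial in
/-- Two expressions for the numerator of the Rodrigues formula; eliminating the derivative of order
`l` of `(X ^ 2 - 1) ^ (l + 1)` between them yields the three-term recurrence. They
come from differentiating `(X ^ 2 - 1) ^ (l + 2)` once and twice. -/
theorem iterate_derivative_X_sq_sub_one_pow (l : ℕ) :
    (derivative^[l + 2] ((X ^ 2 - 1 : ℝ[X]) ^ (l + 2)) =
      2 * ((l : ℝ[X]) + 2) * (X * derivative^[l + 1] ((X ^ 2 - 1 : ℝ[X]) ^ (l + 1)) +
        ((l : ℝ[X]) + 1) * derivative^[l] ((X ^ 2 - 1 : ℝ[X]) ^ (l + 1)))) ∧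
    (derivative^[l + 2] ((X ^ 2 - 1 : ℝ[X]) ^ (l + 2)) =
      2 * ((l : ℝ[X]) + 2) * (2 * (l : ℝ[X]) + 3) * derivative^[l] ((X ^ 2 - 1 : ℝ[X]) ^ (l + 1)) +
        4 * ((l : ℝ[X]) + 1) * ((l : ℝ[X]) + 2) * derivative^[l] ((X ^ 2 - 1 : ℝ[X]) ^ l)) := by
  have hC2 : (C 2 : ℝ[X]) = 2 := map_ofNat C 2
  have hC3 : (C 3 : ℝ[X]) = 3 := map_ofNat C 3
  have hC4 : (C 4 : ℝ[X]) = 4 := map_ofNat C 4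
  have h1 (m : ℕ) : derivative ((X ^ 2 - 1 : ℝ[X]) ^ (m + 1)) =
      C (2 * ((m : ℝ) + 1)) * (X * (X ^ 2 - 1 : ℝ[X]) ^ m) := by
    rw [derivative_pow_succ]
    simp [hC2]
    ring
  have h2 : derivative (derivative ((X ^ 2 - 1 : ℝ[X]) ^ (l + 2))) =
      C (2 * ((l : ℝ) + 2) * (2 * l + 3)) * (X ^ 2 - 1 : ℝ[X]) ^ (l + 1) +
        C (4 * ((l : ℝ) + 1) * (l + 2)) * (X ^ 2 - 1 : ℝ[X]) ^ l := by
    rw [h1 (l + 1), derivative_C_mul, derivative_mul, h1 l]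
    simp [hC2, hC3, hC4]
    ring
  constructor
  · rw [Function.iterate_succ_apply, h1 (l + 1), iterate_derivative_C_mul,
      mul_comm X, iterate_derivative_mul_X]
    simp only [Function.iterate_succ_apply, map_mul, map_add, hC2, map_one, map_natCast,
      nsmul_eq_mul, Nat.add_sub_cancel]
    push_cast
    ring
  · rw [Function.iterate_succ_apply, Function.iterate_succ_apply, h2, iterate_map_add,
      iterate_derivative_C_mul, iterate_derivative_C_mul]
    simp [hC2, hC3, hC4]

/-- The three-term recurrence of the Legendre polynomials. -/
theorem legendreP_recurrence (l : ℕ) (x : ℝ) :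
    ((l : ℝ) + 2) * (legendreP (l + 2)).eval x =
      (2 * l + 3) * x * (legendreP (l + 1)).eval x - (l + 1) * (legendreP l).eval x := by
  obtain ⟨h1, h2⟩ := iterate_derivative_X_sq_sub_one_pow l
  have h1' := congrArg (Polynomial.eval x) h1
  have h2' := congrArg (Polynomial.eval x) h2
  simp only [legendreP, Polynomial.eval_mul, Polynomial.eval_C]
  simp only [Polynomial.eval_mul, Polynomial.eval_add, Polynomial.eval_X, Polynomial.eval_natCast,
    Polynomial.eval_ofNat, Polynomial.eval_one] at h1' h2'
  set a := Polynomial.eval x (Polynomial.derivative^[l + 2] ((Polynomial.X ^ 2 - 1) ^ (l + 2)))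
  set b := Polynomial.eval x (Polynomial.derivative^[l + 1] ((Polynomial.X ^ 2 - 1) ^ (l + 1)))
  set c := Polynomial.eval x (Polynomial.derivative^[l] ((Polynomial.X ^ 2 - 1) ^ l))
  set e := Polynomial.eval x (Polynomial.derivative^[l] ((Polynomial.X ^ 2 - 1) ^ (l + 1)))
  have hl : (l.factorial : ℝ) ≠ 0 := by positivity
  have hl1 : (l : ℝ) + 1 ≠ 0 := by positivity
  have hl2 : (l : ℝ) + 2 ≠ 0 := by positivity
  have key : ((l : ℝ) + 2) * a = (2 * l + 3) * (2 * (l + 2)) * x * b -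
      4 * (l + 1) * (l + 1) * (l + 2) * c := by
    linear_combination (2 * (l : ℝ) + 3) * h1' - ((l : ℝ) + 1) * h2'
  simp only [Nat.factorial_succ, pow_succ]
  push_cast
  field_simp
  linear_combination key

theorem legendreP_zero_eval (x : ℝ) : (legendreP 0).eval x = 1 := by
  simp [legendreP]

theorem legendreP_one_eval (x : ℝ) : (legendreP 1).eval x = x := by
  simp [legendreP]
  ring

/-- The coefficients of the power series of `(1 - u) ^ (-1 / 2)`. -/
def invSqrtCoeff (n : ℕ) : ℝ := (n.centralBinom : ℝ) / 4 ^ n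

theorem invSqrtCoeff_nonneg (n : ℕ) : 0 ≤ invSqrtCoeff n := by
  unfold invSqrtCoeff; positivity

theorem invSqrtCoeff_succ (n : ℕ) :
    2 * ((n : ℝ) + 1) * invSqrtCoeff (n + 1) = (2 * n + 1) * invSqrtCoeff n := by
  have h : ((n : ℝ) + 1) * ((n + 1).centralBinom : ℝ) = 2 * (2 * n + 1) * (n.centralBinom : ℝ) := by
    exact_mod_cast n.succ_mul_centralBinom_succ
  unfold invSqrtCoeff
  rw [pow_succ]
  field_simp
  linear_combination 2 * h

section GeneratingFunction

open PowerSeries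

/-- The formal power series of `(1 - z u) ^ (-1 / 2)` in the variable `u`. -/
def invSqrtSeries (z : ℂ) : PowerSeries ℂ := PowerSeries.mk fun n => (invSqrtCoeff n : ℂ) * z ^ n

/-- The generating function `∑ P_l(x) u ^ l` of the Legendre polynomials, as a formal power series
in `u`. -/
def legendreSeries (x : ℝ) : PowerSeries ℂ :=
  PowerSeries.mk fun l => (((legendreP l).eval x : ℝ) : ℂ)

/-- The quadratic polynomial `1 - 2 x u + u ^ 2` in the variable `u`. -/
def legendreQuadratic (x : ℝ) : PowerSeries ℂ := 1 - C (2 * (x : ℂ)) * X + X ^ 2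

theorem constantCoeff_invSqrtSeries (z : ℂ) : constantCoeff (invSqrtSeries z) = 1 := by
  rw [← coeff_zero_eq_constantCoeff_apply]
  simp [-coeff_zero_eq_constantCoeff, invSqrtSeries, invSqrtCoeff]

theorem constantCoeff_legendreSeries (x : ℝ) : constantCoeff (legendreSeries x) = 1 := by
  rw [← coeff_zero_eq_constantCoeff_apply]
  simp [-coeff_zero_eq_constantCoeff, legendreSeries, legendreP_zero_eval]

/-- The derivative of the left side vanishes, by the differential equation
`2 (1 - z u) S' = z S` that the recurrence of the central binomial coefficients expresses. -/
theorem invSqrtSeries_sq (z : ℂ) : (1 - C z * X) * invSqrtSeries z ^ 2 = 1 := by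
  have hode : 2 * ((1 - C z * X) * d⁄dX ℂ (invSqrtSeries z)) = C z * invSqrtSeries z := by
    ext n
    have h2 : (2 : PowerSeries ℂ) = C (2 : ℂ) := (map_ofNat C 2).symm
    rw [sub_mul, one_mul, h2, coeff_C_mul, coeff_C_mul, map_sub, mul_assoc, coeff_C_mul]
    rcases n with _ | n
    · have := invSqrtCoeff_succ 0
      have h : (2 : ℂ) * (invSqrtCoeff 1 : ℂ) = invSqrtCoeff 0 := by
        rw [← Complex.ofReal_ofNat, ← Complex.ofReal_mul]
        congr 1; simpa using this
      rw [coeff_zero_X_mul]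
      simp [-coeff_zero_eq_constantCoeff, invSqrtSeries, coeff_derivative]
      linear_combination z * h
    · have := invSqrtCoeff_succ (n + 1)
      have h : 2 * ((n : ℂ) + 1 + 1) * (invSqrtCoeff (n + 2) : ℂ) =
          (2 * ((n : ℂ) + 1) + 1) * invSqrtCoeff (n + 1) := by
        push_cast at this; exact_mod_cast this
      rw [coeff_succ_X_mul]
      simp only [invSqrtSeries, coeff_derivative, coeff_mk]
      push_cast
      linear_combination z ^ (n + 2) * h
  apply PowerSeries.derivative.ext
  · have : d⁄dX ℂ ((1 - C z * X) * invSqrtSeries z ^ 2) =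
        invSqrtSeries z * (2 * ((1 - C z * X) * d⁄dX ℂ (invSqrtSeries z)) -
          C z * invSqrtSeries z) := by
      simp [Derivation.leibniz, pow_two, smul_eq_mul]
      ring
    rw [this, hode, sub_self, mul_zero]; simp
  · simp [constantCoeff_invSqrtSeries]

/-- The three-term recurrence, as a differential equation for the generating function. -/
theorem legendreQuadratic_mul_derivative (x : ℝ) :
    legendreQuadratic x * d⁄dX ℂ (legendreSeries x) = (C (x : ℂ) - X) * legendreSeries x := by
  ext n
  rw [legendreQuadratic, add_mul, sub_mul, one_mul, map_add, map_sub, mul_assoc, coeff_C_mul,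
    sub_mul, map_sub, coeff_C_mul, pow_two, mul_assoc X X]
  rcases n with _ | _ | n
  · rw [coeff_zero_X_mul, coeff_zero_X_mul, coeff_zero_X_mul]
    simp [-coeff_zero_eq_constantCoeff, legendreSeries, coeff_derivative, legendreP_zero_eval,
      legendreP_one_eval]
  · have h := legendreP_recurrence 0 x
    have h' : (2 : ℂ) * (((legendreP 2).eval x : ℝ) : ℂ) = 3 * x * x - 1 := by
      rw [legendreP_zero_eval, legendreP_one_eval] at h
      simp only [zero_add] at h
      push_cast at h
      have := congrArg (Complex.ofReal) h
      push_cast at this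
      linear_combination this
    rw [coeff_succ_X_mul, coeff_succ_X_mul, coeff_zero_X_mul, coeff_succ_X_mul]
    simp [-coeff_zero_eq_constantCoeff, legendreSeries, coeff_derivative, legendreP_zero_eval,
      legendreP_one_eval]
    linear_combination h'
  · have h := legendreP_recurrence (n + 1) x
    have h' := congrArg (Complex.ofReal) h
    push_cast at h'
    rw [coeff_succ_X_mul, coeff_succ_X_mul, coeff_succ_X_mul, coeff_succ_X_mul]
    simp only [legendreSeries, coeff_derivative, coeff_mk]
    push_cast
    linear_combination h'

theorem legendreSeries_sq (x : ℝ) : legendreQuadratic x * legendreSeries x ^ 2 = 1 := by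
  apply PowerSeries.derivative.ext
  · have h2 : d⁄dX ℂ (legendreQuadratic x) = 2 * (X - C (x : ℂ)) := by
      rw [legendreQuadratic, map_add, map_sub, Derivation.leibniz, pow_two, Derivation.leibniz,
        PowerSeries.derivative_C, PowerSeries.derivative_X, PowerSeries.derivative_one, map_mul,
        show (C 2 : PowerSeries ℂ) = 2 from map_ofNat C 2]
      simp only [smul_eq_mul]
      ring
    have : d⁄dX ℂ (legendreQuadratic x * legendreSeries x ^ 2) =
        2 * legendreSeries x * (legendreQuadratic x * d⁄dX ℂ (legendreSeries x) -
          (C (x : ℂ) - X) * legendreSeries x) := by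
      rw [Derivation.leibniz, h2]
      simp [Derivation.leibniz, pow_two, smul_eq_mul]
      ring
    rw [this, legendreQuadratic_mul_derivative, sub_self, mul_zero]; simp
  · simp [constantCoeff_legendreSeries, legendreQuadratic]

/-- Factorisation of the generating function at the roots `a⁻¹`, `b⁻¹` of `1 - 2 x u + u ^ 2`. -/
theorem legendreSeries_eq_mul {a b : ℂ} {x : ℝ} (hab : a * b = 1) (hx : a + b = 2 * x) :
    legendreSeries x = invSqrtSeries a * invSqrtSeries b := by
  have hq : legendreQuadratic x = (1 - C a * X) * (1 - C b * X) := by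
    have h1 : (C (2 * (x : ℂ)) : PowerSeries ℂ) = C a + C b := by rw [← map_add, hx]
    have h2 : (C a * C b : PowerSeries ℂ) = 1 := by rw [← map_mul, hab, map_one]
    rw [legendreQuadratic, h1]
    linear_combination (-X ^ 2) * h2
  have h0 : legendreQuadratic x * (legendreSeries x ^ 2) =
      legendreQuadratic x * ((invSqrtSeries a * invSqrtSeries b) ^ 2) := by
    rw [legendreSeries_sq, hq]
    linear_combination (-1 : PowerSeries ℂ) * invSqrtSeries_sq a *
      ((1 - C b * X) * invSqrtSeries b ^ 2) - invSqrtSeries_sq b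
  have hne : legendreQuadratic x ≠ 0 := by
    intro h
    have := legendreSeries_sq x
    rw [h, zero_mul] at this
    exact zero_ne_one this
  rcases sq_eq_sq_iff_eq_or_eq_neg.mp (mul_left_cancel₀ hne h0) with h | h
  · exact h
  · -- the constant coefficients of both sides are `1`, which excludes the minus sign
    exfalso
    have := congrArg constantCoeff h
    simp only [map_neg, map_mul, constantCoeff_legendreSeries, constantCoeff_invSqrtSeries] at this
    norm_num at this

/-- `P_l(cos θ) = ∑_{m + n = l} a_m a_n exp(i (m - n) θ)` with positive coefficients. -/
theorem legendreP_eq_sum {a b : ℂ} {x : ℝ} (hab : a * b = 1) (hx : a + b = 2 * x) (l : ℕ) :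
    (((legendreP l).eval x : ℝ) : ℂ) = ∑ k ∈ Finset.HasAntidiagonal.antidiagonal l,
      ((invSqrtCoeff k.1 * invSqrtCoeff k.2 : ℝ) : ℂ) * (a ^ k.1 * b ^ k.2) := by
  have h := congrArg (coeff l) (legendreSeries_eq_mul hab hx)
  rw [coeff_mul] at h
  simp only [legendreSeries, invSqrtSeries, coeff_mk] at h
  rw [h]
  refine Finset.sum_congr rfl fun k _ => ?_
  push_cast; ring

/-- The coefficients in `legendreP_eq_sum` sum to `1`, as `S ^ 2 = (1 - u)⁻¹` for the series `S` of
`(1 - u) ^ (-1 / 2)`. -/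
theorem sum_invSqrtCoeff (l : ℕ) :
    ∑ k ∈ Finset.HasAntidiagonal.antidiagonal l, invSqrtCoeff k.1 * invSqrtCoeff k.2 = 1 := by
  have h1 : invSqrtSeries 1 ^ 2 = PowerSeries.mk 1 := by
    have h := invSqrtSeries_sq 1
    have h' := PowerSeries.mk_one_mul_one_sub_eq_one ℂ
    rw [map_one, one_mul] at h
    linear_combination (PowerSeries.mk 1) * h - (invSqrtSeries 1 ^ 2) * h'
  have h := congrArg (coeff l) h1
  rw [pow_two, coeff_mul] at h
  simp only [invSqrtSeries, coeff_mk, one_pow, mul_one, Pi.one_apply] at h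
  exact_mod_cast h

theorem legendreP_one (l : ℕ) : (legendreP l).eval 1 = 1 := by
  have h := legendreP_eq_sum (a := 1) (b := 1) (x := 1) (by simp) (by norm_num) l
  simp only [one_pow, mul_one] at h
  refine Eq.trans ?_ (sum_invSqrtCoeff l)
  exact_mod_cast h

/-- The two unimodular numbers `exp(± i θ)` with `cos θ = x`; their distance to `1` is the chord. -/
theorem exists_unit_roots {x : ℝ} (hx : |x| ≤ 1) :
    ∃ a b : ℂ, a * b = 1 ∧ a + b = 2 * x ∧ ‖a‖ = 1 ∧ ‖b‖ = 1 ∧ ‖a - 1‖ = ‖b - 1‖ ∧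
      ‖a - 1‖ ^ 2 = 2 * (1 - x) := by
  have hs : 0 ≤ 1 - x ^ 2 := by
    have := (sq_le_one_iff_abs_le_one x).2 hx; linarith
  have hs2 := Real.sq_sqrt hs
  refine ⟨⟨x, √(1 - x ^ 2)⟩, ⟨x, -√(1 - x ^ 2)⟩, ?_, ?_, ?_, ?_, ?_, ?_⟩
  · apply Complex.ext <;> simp
    · nlinarith
    · ring
  · apply Complex.ext <;> simp
    ring
  · rw [← sq_eq_sq₀ (norm_nonneg _) zero_le_one, Complex.sq_norm, Complex.normSq_apply]
    simp; nlinarith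
  · rw [← sq_eq_sq₀ (norm_nonneg _) zero_le_one, Complex.sq_norm, Complex.normSq_apply]
    simp; nlinarith
  · rw [← sq_eq_sq₀ (norm_nonneg _) (norm_nonneg _), Complex.sq_norm, Complex.sq_norm,
      Complex.normSq_apply, Complex.normSq_apply]
    simp
  · rw [Complex.sq_norm, Complex.normSq_apply]
    simp; nlinarith

theorem abs_legendreP_le_one {x : ℝ} (hx : |x| ≤ 1) (l : ℕ) : |(legendreP l).eval x| ≤ 1 := by
  obtain ⟨a, b, hab, hxs, ha, hb, -, -⟩ := exists_unit_roots hx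
  rw [← Real.norm_eq_abs, ← Complex.norm_real, legendreP_eq_sum hab hxs l, ← sum_invSqrtCoeff l]
  refine (norm_sum_le _ _).trans (Finset.sum_le_sum fun k _ => ?_)
  rw [norm_mul, norm_mul, norm_pow, norm_pow, ha, hb, Complex.norm_real, Real.norm_eq_abs,
    abs_of_nonneg (mul_nonneg (invSqrtCoeff_nonneg _) (invSqrtCoeff_nonneg _))]
  simp

theorem norm_pow_sub_one_le_mul {a : ℂ} (ha : ‖a‖ = 1) (n : ℕ) : ‖a ^ n - 1‖ ≤ n * ‖a - 1‖ := by
  induction n with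
  | zero => simp
  | succ n ih =>
    have : a ^ (n + 1) - 1 = a ^ n * (a - 1) + (a ^ n - 1) := by ring
    rw [this]
    refine (norm_add_le _ _).trans ?_
    rw [norm_mul, norm_pow, ha, one_pow]
    push_cast
    linarith

/-- Real parts in `legendreP_eq_sum`: `1 - Re u = |u - 1| ^ 2 / 2` for the unimodular number
`u = exp(i (m - n) θ)`, and `|u - 1| ≤ (m + n) |exp(i θ) - 1|`. -/
theorem one_sub_legendreP_le {x : ℝ} (hx : |x| ≤ 1) (l : ℕ) :
    1 - (legendreP l).eval x ≤ (l : ℝ) ^ 2 * (1 - x) := by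
  obtain ⟨a, b, hab, hxs, ha, hb, hab1, ha1⟩ := exists_unit_roots hx
  have h : (legendreP l).eval x = ∑ k ∈ Finset.HasAntidiagonal.antidiagonal l,
      (invSqrtCoeff k.1 * invSqrtCoeff k.2) * (a ^ k.1 * b ^ k.2).re := by
    have := congrArg Complex.re (legendreP_eq_sum hab hxs l)
    rw [Complex.ofReal_re, Complex.re_sum] at this
    rw [this]
    refine Finset.sum_congr rfl fun k _ => ?_
    rw [Complex.re_ofReal_mul]
  have h1 : 1 - (legendreP l).eval x = ∑ k ∈ Finset.HasAntidiagonal.antidiagonal l,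
      (invSqrtCoeff k.1 * invSqrtCoeff k.2) * (1 - (a ^ k.1 * b ^ k.2).re) := by
    simp only [mul_sub, mul_one, Finset.sum_sub_distrib, sum_invSqrtCoeff, h]
  have h2 : (l : ℝ) ^ 2 * (1 - x) = ∑ k ∈ Finset.HasAntidiagonal.antidiagonal l,
      (invSqrtCoeff k.1 * invSqrtCoeff k.2) * ((l : ℝ) ^ 2 * (1 - x)) := by
    rw [← Finset.sum_mul, sum_invSqrtCoeff, one_mul]
  rw [h1, h2]
  refine Finset.sum_le_sum fun k hk => mul_le_mul_of_nonneg_left ?_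
    (mul_nonneg (invSqrtCoeff_nonneg _) (invSqrtCoeff_nonneg _))
  set u := a ^ k.1 * b ^ k.2 with hu
  have hun : ‖u‖ = 1 := by simp [hu, ha, hb]
  have hu1 : ‖u - 1‖ ^ 2 = 2 * (1 - u.re) := by
    have h3 : ‖u‖ ^ 2 = 1 := by rw [hun]; norm_num
    rw [Complex.sq_norm, Complex.normSq_apply] at h3 ⊢
    simp
    nlinarith
  have hkl : (k.1 : ℝ) + k.2 = l := by exact_mod_cast Finset.HasAntidiagonal.mem_antidiagonal.1 hk
  have hu2 : ‖u - 1‖ ≤ l * ‖a - 1‖ := by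
    have : u - 1 = a ^ k.1 * (b ^ k.2 - 1) + (a ^ k.1 - 1) := by rw [hu]; ring
    rw [this, ← hkl, add_mul]
    refine (norm_add_le _ _).trans ?_
    rw [norm_mul, norm_pow, ha, one_pow, one_mul, add_comm]
    exact add_le_add (norm_pow_sub_one_le_mul ha _) (hab1 ▸ norm_pow_sub_one_le_mul hb _)
  have hu3 := pow_le_pow_left₀ (norm_nonneg _) hu2 2
  rw [mul_pow, hu1, ha1] at hu3
  linarith

end GeneratingFunction

/-! ### The Poisson sum of the Legendre polynomials -/

section PowerSeriesEvaluation

variable {r : ℂ}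

/-- The sum of a formal power series at a complex number; the default value `0` of `tsum` where the
series is not summable. -/
def evalSeries (r : ℂ) (f : PowerSeries ℂ) : ℂ := ∑' n, PowerSeries.coeff n f * r ^ n

theorem evalSeries_mul {f g : PowerSeries ℂ}
    (hf : Summable fun n => ‖PowerSeries.coeff n f * r ^ n‖)
    (hg : Summable fun n => ‖PowerSeries.coeff n g * r ^ n‖) :
    (Summable fun n => ‖PowerSeries.coeff n (f * g) * r ^ n‖) ∧
      evalSeries r (f * g) = evalSeries r f * evalSeries r g := by
  have h (n : ℕ) : PowerSeries.coeff n (f * g) * r ^ n =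
      ∑ k ∈ Finset.HasAntidiagonal.antidiagonal n,
        (PowerSeries.coeff k.1 f * r ^ k.1) * (PowerSeries.coeff k.2 g * r ^ k.2) := by
    rw [PowerSeries.coeff_mul, Finset.sum_mul]
    refine Finset.sum_congr rfl fun k hk => ?_
    rw [← Finset.HasAntidiagonal.mem_antidiagonal.1 hk, pow_add]
    ring
  have h1 := summable_norm_sum_mul_antidiagonal_of_summable_norm
    (f := fun n => PowerSeries.coeff n f * r ^ n)
    (g := fun n => PowerSeries.coeff n g * r ^ n) hf hg
  have h2 := tsum_mul_tsum_eq_tsum_sum_antidiagonal_of_summable_norm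
    (f := fun n => PowerSeries.coeff n f * r ^ n)
    (g := fun n => PowerSeries.coeff n g * r ^ n) hf hg
  refine ⟨h1.congr fun n => by rw [h n], ?_⟩
  rw [evalSeries, evalSeries, evalSeries, h2]
  exact tsum_congr h

theorem summable_evalSeries_poly (P : Polynomial ℂ) :
    Summable fun n => ‖PowerSeries.coeff n (P : PowerSeries ℂ) * r ^ n‖ := by
  refine summable_of_ne_finset_zero (s := P.support) fun n hn => ?_
  rw [Polynomial.coeff_coe, Polynomial.notMem_support_iff.1 hn]
  simp

theorem evalSeries_poly (P : Polynomial ℂ) : evalSeries r (P : PowerSeries ℂ) = P.eval r := by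
  rw [evalSeries, Polynomial.eval_eq_sum, Polynomial.sum, tsum_eq_sum (s := P.support)]
  · simp
  · intro n hn
    rw [Polynomial.coeff_coe, Polynomial.notMem_support_iff.1 hn]
    simp

end PowerSeriesEvaluation

/-- The generating function `∑ (2 l + 1) P_l(x) u ^ l`, as a formal power series in `u`. -/
def poissonSeries (x : ℝ) : PowerSeries ℂ :=
  PowerSeries.mk fun l => (2 * (l : ℂ) + 1) * (((legendreP l).eval x : ℝ) : ℂ)

open PowerSeries in
/-- With `G` the generating function, the series on the left is `2 u G' + G`; `G'` is eliminated by
the differential equation. -/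
theorem legendreQuadratic_mul_poissonSeries (x : ℝ) :
    legendreQuadratic x * poissonSeries x = (1 - X ^ 2) * legendreSeries x := by
  have h : poissonSeries x = 2 * (X * d⁄dX ℂ (legendreSeries x)) + legendreSeries x := by
    ext n
    have h2 : (2 : PowerSeries ℂ) = C (2 : ℂ) := (map_ofNat C 2).symm
    rw [h2, map_add, coeff_C_mul]
    rcases n with _ | n
    · rw [coeff_zero_X_mul]; simp [-coeff_zero_eq_constantCoeff, poissonSeries, legendreSeries]
    · rw [coeff_succ_X_mul]
      simp only [poissonSeries, legendreSeries, coeff_derivative, coeff_mk]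
      push_cast; ring
  have hq : legendreQuadratic x = 1 - 2 * C (x : ℂ) * X + X ^ 2 := by
    rw [legendreQuadratic, map_mul, show (C 2 : PowerSeries ℂ) = 2 from map_ofNat C 2]
  have h3 := legendreQuadratic_mul_derivative x
  rw [h]
  linear_combination 2 * X * h3 + legendreSeries x * hq

theorem summable_norm_legendre {x : ℝ} (hx : |x| ≤ 1) {r : ℂ} (hr : ‖r‖ < 1) :
    (Summable fun n => ‖PowerSeries.coeff n (legendreSeries x) * r ^ n‖) ∧
      (Summable fun n => ‖PowerSeries.coeff n (poissonSeries x) * r ^ n‖) := by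
  have h0 : Summable fun n : ℕ => ‖r‖ ^ n := summable_geometric_of_lt_one (norm_nonneg _) hr
  have h1 : Summable fun n : ℕ => (n : ℝ) ^ 1 * ‖r‖ ^ n :=
    summable_pow_mul_geometric_of_norm_lt_one 1 (by simpa using hr)
  have hp (n : ℕ) := abs_legendreP_le_one hx n
  constructor
  · refine h0.of_nonneg_of_le (fun _ => norm_nonneg _) fun n => ?_
    rw [norm_mul, norm_pow, legendreSeries, PowerSeries.coeff_mk, Complex.norm_real,
      Real.norm_eq_abs]
    exact mul_le_of_le_one_left (by positivity) (hp n)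
  · refine ((h1.mul_left 2).add h0).of_nonneg_of_le (fun _ => norm_nonneg _) fun n => ?_
    rw [norm_mul, norm_pow, poissonSeries, PowerSeries.coeff_mk, norm_mul, Complex.norm_real,
      Real.norm_eq_abs]
    have h2 : ‖2 * (n : ℂ) + 1‖ = 2 * n + 1 := by
      rw [show (2 * (n : ℂ) + 1) = ((2 * n + 1 : ℕ) : ℂ) by push_cast; ring, Complex.norm_natCast]
      push_cast; ring
    rw [h2]
    have := mul_le_of_le_one_right (a := 2 * (n : ℝ) + 1) (by positivity) (hp n)
    have h3 := mul_le_mul_of_nonneg_right this (pow_nonneg (norm_nonneg r) n)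
    linarith

/-- The Poisson sum equals `(1 - r ^ 2) G / D` with `D = 1 - 2 x r + r ^ 2` and `G ^ 2 D = 1`;
the absolute value of this is controlled by a lower bound for `|D|` alone. -/
theorem norm_poisson_le {x : ℝ} (hx : |x| ≤ 1) {r : ℂ} (hr : ‖r‖ < 1) {c : ℝ} (hc : 0 < c)
    (hD : c ^ 2 ≤ ‖1 - 2 * (x : ℂ) * r + r ^ 2‖) :
    ‖∑' l : ℕ, (2 * (l : ℂ) + 1) * (((legendreP l).eval x : ℝ) : ℂ) * r ^ l‖ ≤
      ‖1 - r ^ 2‖ / c ^ 3 := by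
  obtain ⟨hG, hK⟩ := summable_norm_legendre hx hr
  set D := 1 - 2 * (x : ℂ) * r + r ^ 2 with hDdef
  set PD : Polynomial ℂ := 1 - Polynomial.C (2 * (x : ℂ)) * Polynomial.X + Polynomial.X ^ 2
  set P1 : Polynomial ℂ := 1 - Polynomial.X ^ 2
  have hPD : (PD : PowerSeries ℂ) = legendreQuadratic x := by
    simp [PD, legendreQuadratic]
  have hP1 : (P1 : PowerSeries ℂ) = 1 - PowerSeries.X ^ 2 := by simp [P1]
  have e1 : evalSeries r (legendreQuadratic x) = D := by
    rw [← hPD, evalSeries_poly]; simp [PD, hDdef]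
  have sD : Summable fun n => ‖PowerSeries.coeff n (legendreQuadratic x) * r ^ n‖ := by
    rw [← hPD]; exact summable_evalSeries_poly _
  obtain ⟨sGG, eGG⟩ := evalSeries_mul hG hG
  have eG : D * (evalSeries r (legendreSeries x) * evalSeries r (legendreSeries x)) = 1 := by
    rw [← eGG, ← e1, ← (evalSeries_mul sD sGG).2, ← pow_two, legendreSeries_sq,
      ← Polynomial.coe_one, evalSeries_poly, Polynomial.eval_one]
  have eK : D * evalSeries r (poissonSeries x) = (1 - r ^ 2) * evalSeries r (legendreSeries x) := by
    rw [← e1, ← (evalSeries_mul sD hK).2, legendreQuadratic_mul_poissonSeries, ← hP1,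
      (evalSeries_mul (summable_evalSeries_poly P1) hG).2, evalSeries_poly]
    simp [P1]
  have hsum : ∑' l : ℕ, (2 * (l : ℂ) + 1) * (((legendreP l).eval x : ℝ) : ℂ) * r ^ l =
      evalSeries r (poissonSeries x) := by
    simp [evalSeries, poissonSeries]
  rw [hsum]
  set G := evalSeries r (legendreSeries x)
  set K := evalSeries r (poissonSeries x)
  have nG : ‖D‖ * ‖G‖ ^ 2 = 1 := by
    rw [pow_two, ← norm_mul, ← norm_mul, eG, norm_one]
  have nK : ‖D‖ * ‖K‖ = ‖1 - r ^ 2‖ * ‖G‖ := by rw [← norm_mul, ← norm_mul, eK]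
  have hGc : c * ‖G‖ ≤ 1 := by
    have : (c * ‖G‖) ^ 2 ≤ 1 := by
      rw [mul_pow, ← nG]; gcongr
    exact (sq_le_one_iff₀ (by positivity)).1 this
  rw [le_div_iff₀ (by positivity)]
  calc ‖K‖ * c ^ 3 = c * (c ^ 2 * ‖K‖) := by ring
    _ ≤ c * (‖D‖ * ‖K‖) := by gcongr
    _ = ‖1 - r ^ 2‖ * (c * ‖G‖) := by rw [nK]; ring
    _ ≤ ‖1 - r ^ 2‖ := mul_le_of_le_one_right (norm_nonneg _) hGc

/-- Lower bound for `|1 - 2 x r + r ^ 2|` in terms of the distance from `r` to `1` and of the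
squared chord `2 (1 - x)`: the quadratic is `(1 - a r) (1 - a' r)` with unimodular `a`, `a'`, and
also `(1 - r) ^ 2 + 2 (1 - x) r`. -/
theorem norm_quadratic_ge {x : ℝ} (hx : |x| ≤ 1) {r : ℂ} {κ t b : ℝ} (hκ : 0 < κ) (hκ1 : κ ≤ 1)
    (ht : 0 < t) (hb : 1 ≤ b) (hr : κ ≤ ‖r‖) (hr1 : 2 * κ * t ≤ 1 - ‖r‖)
    (hr2 : ‖1 - r‖ ≤ 2 * t * b) {m : ℝ}
    (hm : m ^ 2 ≤ max (t ^ 2) (2 * (1 - x))) :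
    (κ ^ 2 / 4 * m / b) ^ 2 ≤ ‖1 - 2 * (x : ℂ) * r + r ^ 2‖ := by
  set D := 1 - 2 * (x : ℂ) * r + r ^ 2
  have hD1 : 4 * κ ^ 2 * t ^ 2 ≤ ‖D‖ := by
    obtain ⟨a, a', haa, hax, ha, ha', -, -⟩ := exists_unit_roots hx
    have hD : D = (1 - a * r) * (1 - a' * r) := by
      simp only [D, ← hax]; linear_combination (-r ^ 2) * haa
    have h1 (z : ℂ) (hz : ‖z‖ = 1) : 2 * κ * t ≤ ‖1 - z * r‖ := by
      have := norm_sub_norm_le (1 : ℂ) (z * r)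
      rw [norm_one, norm_mul, hz, one_mul] at this
      linarith
    rw [hD, norm_mul]
    calc 4 * κ ^ 2 * t ^ 2 = (2 * κ * t) * (2 * κ * t) := by ring
      _ ≤ _ := mul_le_mul (h1 a ha) (h1 a' ha') (by positivity) (norm_nonneg _)
  set q := 2 * (1 - x)
  have hq : 0 ≤ q := by have := (abs_le.1 hx).2; simp only [q]; linarith
  have hD2 : κ * q - ‖1 - r‖ ^ 2 ≤ ‖D‖ := by
    have hD : r * (q : ℂ) - -(1 - r) ^ 2 = D := by simp only [D, q]; push_cast; ring
    have := norm_sub_norm_le (r * (q : ℂ)) (-(1 - r) ^ 2)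
    rw [hD, norm_neg, norm_pow, norm_mul, Complex.norm_real, Real.norm_eq_abs, abs_of_nonneg hq]
      at this
    have h3 := mul_le_mul_of_nonneg_right hr hq
    linarith
  have hκ2 : κ ^ 2 ≤ 1 := pow_le_one₀ hκ.le hκ1
  have hκ3 : κ ^ 2 ≤ κ := by nlinarith
  have hκ4 : κ ^ 4 ≤ κ ^ 2 := by nlinarith
  have hκ43 : κ ^ 4 ≤ κ ^ 3 := by nlinarith [pow_pos hκ 3]
  have hb2 : 1 ≤ b ^ 2 := one_le_pow₀ hb
  have hgoal (h : κ ^ 4 * m ^ 2 ≤ 16 * b ^ 2 * ‖D‖) : (κ ^ 2 / 4 * m / b) ^ 2 ≤ ‖D‖ := by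
    rw [div_pow, div_le_iff₀ (by positivity)]
    nlinarith
  apply hgoal
  have hbD : ‖D‖ ≤ b ^ 2 * ‖D‖ := le_mul_of_one_le_left (norm_nonneg _) hb2
  rcases le_max_iff.1 hm with hm | hm
  · have : κ ^ 4 * m ^ 2 ≤ κ ^ 2 * t ^ 2 := by gcongr
    nlinarith [mul_nonneg (sq_nonneg κ) (sq_nonneg t)]
  -- either `|1 - r|` is small against the chord and `r q` dominates `D`, or the chord is `O(t b)`
  · rcases le_total (‖1 - r‖ ^ 2) (κ * q / 2) with h | h
    · have : κ ^ 4 * m ^ 2 ≤ κ * q := by gcongr; linarith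
      nlinarith
    · have h4 : ‖1 - r‖ ^ 2 ≤ (2 * t * b) ^ 2 := by gcongr
      calc κ ^ 4 * m ^ 2 ≤ κ ^ 3 * q := by gcongr
        _ = 2 * κ ^ 2 * (κ * q / 2) := by ring
        _ ≤ 2 * κ ^ 2 * (2 * t * b) ^ 2 := by gcongr; linarith
        _ = 2 * b ^ 2 * (4 * κ ^ 2 * t ^ 2) := by ring
        _ ≤ 2 * b ^ 2 * ‖D‖ := by gcongr
        _ ≤ 16 * b ^ 2 * ‖D‖ := by gcongr; norm_num

/-! ### Localisation of the kernel -/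

open Complex in
/-- The Gaussian `exp (-z ^ 2) * exp (2 i x z)` on the shifted line `z = w + i`. -/
def shiftedGaussian (x w : ℝ) : ℂ := cexp (-((w : ℂ) + I) ^ 2 + 2 * I * x * ((w : ℂ) + I))

open Complex in
theorem norm_shiftedGaussian (x w : ℝ) :
    ‖shiftedGaussian x w‖ = Real.exp (1 - 2 * x) * Real.exp (-w ^ 2) := by
  rw [shiftedGaussian, Complex.norm_exp, ← Real.exp_add]
  congr 1
  simp [pow_two]
  ring

theorem continuous_shiftedGaussian (x : ℝ) : Continuous (shiftedGaussian x) := by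
  unfold shiftedGaussian; fun_prop

theorem integrable_abs_pow_mul_exp_neg_sq (n : ℕ) :
    Integrable fun w : ℝ => |w| ^ n * Real.exp (-w ^ 2) := by
  have h := (integrable_rpow_mul_exp_neg_mul_sq one_pos (s := n)
    (by have : (0 : ℝ) ≤ n := n.cast_nonneg; linarith)).norm
  refine h.congr (Filter.Eventually.of_forall fun w => ?_)
  simp [abs_of_pos (Real.exp_pos _)]

open Complex in
theorem integrable_norm_poly_mul_exp (P : Polynomial ℂ) :
    Integrable fun w : ℝ => ‖P.eval ((w : ℂ) + I)‖ * Real.exp (-w ^ 2) := by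
  have key (R : Polynomial ℂ) : Integrable fun w : ℝ => ‖R.eval (w : ℂ)‖ * Real.exp (-w ^ 2) := by
    induction R using Polynomial.induction_on' with
    | add p q hp hq =>
      refine (hp.add hq).mono' (by fun_prop) (Filter.Eventually.of_forall fun w => ?_)
      rw [Real.norm_of_nonneg (by positivity), Pi.add_apply, ← add_mul, Polynomial.eval_add]
      gcongr
      exact norm_add_le _ _
    | monomial n a =>
      refine ((integrable_abs_pow_mul_exp_neg_sq n).const_mul ‖a‖).congr
        (Filter.Eventually.of_forall fun w => ?_)
      simp [mul_assoc]
  refine (key (P.comp (Polynomial.X + Polynomial.C I))).congr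
    (Filter.Eventually.of_forall fun w => ?_)
  simp only [Polynomial.eval_comp, Polynomial.eval_add, Polynomial.eval_X, Polynomial.eval_C]

open Complex in
theorem integrable_poly_mul_shiftedGaussian (P : Polynomial ℂ) (x : ℝ) :
    Integrable fun w : ℝ => P.eval ((w : ℂ) + I) * shiftedGaussian x w := by
  refine ((integrable_norm_poly_mul_exp P).const_mul (Real.exp (1 - 2 * x))).mono'
    (Continuous.aestronglyMeasurable
      ((P.continuous.comp (by fun_prop)).mul (continuous_shiftedGaussian x)))
    (Filter.Eventually.of_forall fun w => ?_)
  rw [norm_mul, norm_shiftedGaussian]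
  exact le_of_eq (by ring)

/-- The (physicists') Hermite polynomials, defined by `H_{n+1} = 2 X H_n - H_n'`, with complex
coefficients because they are evaluated off the real line. -/
def hermitePoly : ℕ → Polynomial ℂ
  | 0 => 1
  | n + 1 => 2 * Polynomial.X * hermitePoly n - Polynomial.derivative (hermitePoly n)

open Complex in
/-- On the Fourier side multiplication by `x` is integration by parts against the Gaussian. -/
theorem integral_hermitePoly_mul_shiftedGaussian (x : ℝ) (n : ℕ) :
    ∫ w : ℝ, (hermitePoly n).eval ((w : ℂ) + I) * shiftedGaussian x w =
      (2 * I * x) ^ n * ((√Real.pi * Real.exp (-x ^ 2) : ℝ) : ℂ) := by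
  induction n with
  | zero =>
    have h (w : ℝ) : (hermitePoly 0).eval ((w : ℂ) + I) * shiftedGaussian x w =
        ((Real.exp (-x ^ 2) : ℝ) : ℂ) * cexp (-1 * ((w : ℂ) + ((1 - x : ℝ) : ℂ) * I) ^ 2) := by
      rw [Complex.ofReal_exp, ← Complex.exp_add]
      simp only [hermitePoly, Polynomial.eval_one, one_mul, shiftedGaussian]
      congr 1
      push_cast
      linear_combination (x ^ 2 - 2 * x + 1 - 1 + 2 * x - 0) * I_sq
    simp_rw [h]
    rw [integral_const_mul, GaussianFourier.integral_cexp_neg_mul_sq_add_real_mul_I (by simp),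
      div_one, pow_zero, one_mul, mul_comm, Real.sqrt_eq_rpow, Complex.ofReal_mul,
      Complex.ofReal_cpow Real.pi_pos.le]
    norm_num
  | succ n ih =>
    set P := hermitePoly n
    have hd (w : ℝ) : HasDerivAt (fun w : ℝ => P.eval ((w : ℂ) + I) * shiftedGaussian x w)
        ((2 * I * x) * (P.eval ((w : ℂ) + I) * shiftedGaussian x w) -
          (hermitePoly (n + 1)).eval ((w : ℂ) + I) * shiftedGaussian x w) w := by
      have h1 : HasDerivAt (fun w : ℝ => (w : ℂ) + I) 1 w :=
        (Complex.ofRealCLM.hasDerivAt (x := w)).add_const I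
      have h2 := (P.hasDerivAt ((w : ℂ) + I)).comp w h1
      have h3 : HasDerivAt (shiftedGaussian x) (shiftedGaussian x w *
          (-(2 * ((w : ℂ) + I)) + 2 * I * x)) w := by
        have := ((h1.pow 2).neg.add (h1.const_mul (2 * I * x))).cexp
        refine this.congr_deriv ?_
        simp [shiftedGaussian]
      refine (h2.mul h3).congr_deriv ?_
      rw [show hermitePoly (n + 1) = 2 * Polynomial.X * P - Polynomial.derivative P from rfl]
      simp only [Polynomial.eval_sub, Polynomial.eval_mul, Polynomial.eval_X,
        Polynomial.eval_ofNat, Function.comp]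
      ring
    have i1 := integrable_poly_mul_shiftedGaussian P x
    have i2 := integrable_poly_mul_shiftedGaussian (hermitePoly (n + 1)) x
    have h0 := integral_eq_zero_of_hasDerivAt_of_integrable hd ((i1.const_mul _).sub i2) i1
    rw [integral_sub (i1.const_mul _) i2, integral_const_mul, ih, sub_eq_zero] at h0
    rw [← h0]; ring

open Complex in
theorem weight_eq_integral (s : ℕ) (x : ℝ) :
    (weight s x : ℂ) = (((-1) ^ s / (4 ^ s * √Real.pi) : ℝ) : ℂ) *
      ∫ w : ℝ, (hermitePoly (2 * s)).eval ((w : ℂ) + I) * shiftedGaussian x w := by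
  have h : (2 * I * (x : ℂ)) ^ (2 * s) = (((-1) ^ s * 4 ^ s * x ^ (2 * s) : ℝ) : ℂ) := by
    rw [pow_mul, mul_pow (2 * I), mul_pow 2 I, I_sq, pow_mul]
    push_cast
    rw [← mul_pow, ← mul_pow]
    congr 1; ring
  rw [integral_hermitePoly_mul_shiftedGaussian, h, ← Complex.ofReal_mul, ← Complex.ofReal_mul,
    weight]
  congr 1
  have h1 : ((-1 : ℝ) ^ s) * (-1) ^ s = 1 := by rw [← mul_pow]; simp
  have hp : √Real.pi ≠ 0 := (Real.sqrt_pos.2 Real.pi_pos).ne'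
  field_simp
  linear_combination (-x ^ (2 * s)) * h1

open Complex in
/-- The complex radius `r = exp (2 i t (w + i))` at which the Poisson sum is taken. -/
def poissonRadius (t w : ℝ) : ℂ := cexp (2 * I * t * ((w : ℂ) + I))

open Complex in
theorem norm_poissonRadius (t w : ℝ) : ‖poissonRadius t w‖ = Real.exp (-(2 * t)) := by
  rw [poissonRadius, Complex.norm_exp]; simp

open Complex in
theorem norm_one_sub_poissonRadius_le {t : ℝ} (ht : 0 < t) (w : ℝ) :
    ‖1 - poissonRadius t w‖ ≤ 2 * t * (1 + |w|) := by
  have h : 1 - poissonRadius t w = ((1 - Real.exp (-(2 * t)) : ℝ) : ℂ) -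
      ((Real.exp (-(2 * t)) : ℝ) : ℂ) * (cexp (I * (2 * t * w : ℝ)) - 1) := by
    have : poissonRadius t w = ((Real.exp (-(2 * t)) : ℝ) : ℂ) * cexp (I * (2 * t * w : ℝ)) := by
      rw [Complex.ofReal_exp, ← Complex.exp_add, poissonRadius]
      congr 1
      push_cast
      linear_combination (2 * (t : ℂ)) * I_sq
    rw [this]; push_cast; ring
  have h1 : Real.exp (-(2 * t)) ≤ 1 := Real.exp_le_one_iff.2 (by linarith)
  have h2 := Real.one_sub_le_exp_neg (2 * t)
  have h3 := Real.norm_exp_I_mul_ofReal_sub_one_le (x := 2 * t * w)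
  rw [Real.norm_eq_abs, abs_mul, abs_of_pos (by linarith : 0 < 2 * t)] at h3
  rw [h]
  refine (norm_sub_le _ _).trans ?_
  rw [norm_mul, Complex.norm_real, Complex.norm_real, Real.norm_of_nonneg (by linarith),
    Real.norm_of_nonneg (Real.exp_pos _).le]
  have h4 := mul_le_of_le_one_left (norm_nonneg (cexp (I * (2 * t * w : ℝ)) - 1)) h1
  linarith

theorem shiftedGaussian_nat_mul (t w : ℝ) (l : ℕ) :
    shiftedGaussian (l * t) w = shiftedGaussian 0 w * poissonRadius t w ^ l := by
  rw [shiftedGaussian, shiftedGaussian, poissonRadius, ← Complex.exp_nat_mul, ← Complex.exp_add]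
  congr 1
  push_cast; ring

/-- The kernel is a superposition, with Gaussian weights, of Poisson sums. -/
theorem kernelSeries_eq_integral (s : ℕ) {t : ℝ} (ht : 0 < t) {x : ℝ} (hx : |x| ≤ 1) :
    ((∑' l : ℕ, weight s (l * t) * (2 * (l : ℝ) + 1) * (legendreP l).eval x : ℝ) : ℂ) =
      (((-1) ^ s / (4 ^ s * √Real.pi) : ℝ) : ℂ) *
        ∫ w : ℝ, (hermitePoly (2 * s)).eval ((w : ℂ) + Complex.I) * shiftedGaussian 0 w *
          ∑' l : ℕ, (2 * (l : ℂ) + 1) * (((legendreP l).eval x : ℝ) : ℂ) *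
            poissonRadius t w ^ l := by
  set H := hermitePoly (2 * s)
  set F : ℕ → ℝ → ℂ := fun l w => (2 * (l : ℂ) + 1) * (((legendreP l).eval x : ℝ) : ℂ) *
    (H.eval ((w : ℂ) + Complex.I) * shiftedGaussian (l * t) w) with hF
  have hFint (l : ℕ) : Integrable (F l) :=
    (integrable_poly_mul_shiftedGaussian H (l * t)).const_mul _
  have hFsum : Summable fun l => ∫ w, ‖F l w‖ := by
    have hs := (summable_norm_legendre hx (r := ((Real.exp (-(2 * t)) : ℝ) : ℂ)) (by
      rw [Complex.norm_real, Real.norm_of_nonneg (Real.exp_pos _).le]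
      exact Real.exp_lt_one_iff.2 (by linarith))).2
    refine (hs.mul_right (∫ w : ℝ, ‖H.eval ((w : ℂ) + Complex.I) * shiftedGaussian 0 w‖)).congr
      fun l => ?_
    rw [← integral_const_mul]
    congr 1
    ext w
    rw [hF]
    simp only [shiftedGaussian_nat_mul, norm_mul, norm_pow, norm_poissonRadius, poissonSeries,
      PowerSeries.coeff_mk, Complex.norm_real, Real.norm_of_nonneg (Real.exp_pos _).le]
    ring
  have h := (hasSum_integral_of_summable_integral_norm hFint hFsum).tsum_eq
  have h1 (w : ℝ) : H.eval ((w : ℂ) + Complex.I) * shiftedGaussian 0 w *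
      ∑' l : ℕ, (2 * (l : ℂ) + 1) * (((legendreP l).eval x : ℝ) : ℂ) * poissonRadius t w ^ l =
      ∑' l, F l w := by
    rw [← tsum_mul_left]
    refine tsum_congr fun l => ?_
    rw [hF]
    simp only [shiftedGaussian_nat_mul]
    ring
  simp_rw [h1]
  rw [← h, ← tsum_mul_left, Complex.ofReal_tsum]
  refine tsum_congr fun l => ?_
  rw [hF]
  simp only
  rw [integral_const_mul, Complex.ofReal_mul, Complex.ofReal_mul, weight_eq_integral]
  push_cast
  ring

/-- Localisation: with `m = max(t, chord)` the kernel is at most `C t / m ^ 3`, uniformly for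
bounded `t`. -/
theorem exists_kernelSeries_le (s : ℕ) {T : ℝ} (hT : 0 < T) : ∃ C : ℝ, 0 < C ∧
    ∀ t : ℝ, 0 < t → t ≤ T → ∀ x : ℝ, |x| ≤ 1 → ∀ m : ℝ, 0 < m →
      m ^ 2 ≤ max (t ^ 2) (2 * (1 - x)) →
      |∑' l : ℕ, weight s (l * t) * (2 * (l : ℝ) + 1) * (legendreP l).eval x| ≤ C * t / m ^ 3 := by
  set H := hermitePoly (2 * s)
  set κ : ℝ := Real.exp (-(2 * T)) with hκdef
  have hκ : 0 < κ := Real.exp_pos _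
  have hκ1 : κ ≤ 1 := Real.exp_le_one_iff.2 (by linarith)
  -- the factor `(1 + |w|) ^ 4` collects one power from `1 - r ^ 2` and three from `D`
  set g : ℝ → ℝ := fun w => ‖H.eval ((w : ℂ) + Complex.I)‖ * Real.exp (-w ^ 2) * (1 + |w|) ^ 4
    with hg
  have hgint : Integrable g := by
    have h := integrable_norm_poly_mul_exp
      (H * (8 * (1 + (Polynomial.X - Polynomial.C Complex.I) ^ 4)))
    refine h.mono' (by
      have := H.continuous
      fun_prop) (Filter.Eventually.of_forall fun w => ?_)
    have h1 : ‖(1 + (w : ℂ) ^ 4)‖ = 1 + w ^ 4 := by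
      rw [show (1 + (w : ℂ) ^ 4) = ((1 + w ^ 4 : ℝ) : ℂ) by push_cast; ring, Complex.norm_real,
        Real.norm_of_nonneg (by positivity)]
    have h2 : (1 + |w|) ^ 4 ≤ 8 * (1 + w ^ 4) := by
      have := add_pow_le (zero_le_one) (abs_nonneg w) 4
      have h4 : |w| ^ 4 = w ^ 4 := by rw [← abs_pow, abs_of_nonneg (by positivity)]
      rw [h4] at this
      norm_num at this
      linarith
    rw [hg, Real.norm_of_nonneg (by positivity)]
    simp only [Polynomial.eval_mul, Polynomial.eval_add, Polynomial.eval_sub, Polynomial.eval_X,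
      Polynomial.eval_C, Polynomial.eval_one, Polynomial.eval_pow, Polynomial.eval_ofNat,
      add_sub_cancel_right, norm_mul, h1]
    rw [mul_right_comm, Complex.norm_ofNat]
    gcongr
  set J : ℝ := ∫ w, g w
  have hJ : 0 ≤ J := integral_nonneg fun w => by rw [hg]; positivity
  set A : ℝ := |(-1) ^ s / (4 ^ s * √Real.pi)|
  refine ⟨A * (Real.exp 1 * (4 * (4 / κ ^ 2) ^ 3) * J) + 1, by positivity,
    fun t ht htT x hx m hm hmx => ?_⟩
  have hbound (w : ℝ) : ‖H.eval ((w : ℂ) + Complex.I) * shiftedGaussian 0 w *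
      ∑' l : ℕ, (2 * (l : ℂ) + 1) * (((legendreP l).eval x : ℝ) : ℂ) * poissonRadius t w ^ l‖ ≤
      (Real.exp 1 * (4 * (4 / κ ^ 2) ^ 3) * t / m ^ 3) * g w := by
    set r := poissonRadius t w
    set b : ℝ := 1 + |w|
    have hb : 1 ≤ b := by simp [b]
    have hb0 : 0 < b := by linarith
    have hrn : ‖r‖ = Real.exp (-(2 * t)) := norm_poissonRadius t w
    have hr1 : ‖r‖ < 1 := by rw [hrn]; exact Real.exp_lt_one_iff.2 (by linarith)
    have hκr : κ ≤ ‖r‖ := by rw [hrn]; exact Real.exp_le_exp.2 (by linarith)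
    have hgap : 2 * κ * t ≤ 1 - ‖r‖ := by
      -- `1 - e⁻ᵘ ≥ u e⁻ᵘ` is `e ^ u ≥ 1 + u` multiplied by `e⁻ᵘ`
      have h1 := Real.add_one_le_exp (2 * t)
      have h2 : Real.exp (-(2 * t)) * Real.exp (2 * t) = 1 := by rw [← Real.exp_add]; simp
      have h3 := mul_le_mul_of_nonneg_left h1 (norm_nonneg r)
      rw [hrn] at h3 hκr ⊢
      nlinarith
    have h1r := norm_one_sub_poissonRadius_le ht w
    have hD := norm_quadratic_ge hx hκ hκ1 ht hb hκr hgap h1r hmx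
    have hP := norm_poisson_le hx hr1 (by positivity) hD
    have h1r2 : ‖1 - r ^ 2‖ ≤ 4 * t * b := by
      have : 1 - r ^ 2 = (1 - r) * (1 + r) := by ring
      rw [this, norm_mul]
      have h2 : ‖1 + r‖ ≤ 2 := (norm_add_le _ _).trans (by rw [norm_one]; linarith)
      calc ‖1 - r‖ * ‖1 + r‖ ≤ (2 * t * b) * 2 := by gcongr
        _ = _ := by ring
    rw [norm_mul, norm_mul, norm_shiftedGaussian]
    calc _ ≤ ‖H.eval ((w : ℂ) + Complex.I)‖ * (Real.exp (1 - 2 * 0) * Real.exp (-w ^ 2)) *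
          (4 * t * b / (κ ^ 2 / 4 * m / b) ^ 3) := by
          gcongr
          exact hP.trans (by gcongr)
      _ = _ := by
          rw [hg]
          simp only [mul_zero, sub_zero]
          field_simp
          rfl
  have hnorm := norm_integral_le_of_norm_le (hgint.const_mul _) (Filter.Eventually.of_forall hbound)
  rw [integral_const_mul] at hnorm
  rw [← Real.norm_eq_abs, ← Complex.norm_real, kernelSeries_eq_integral s ht hx, norm_mul,
    Complex.norm_real]
  have hA : ‖((-1 : ℝ) ^ s / (4 ^ s * √Real.pi))‖ = A := rfl
  rw [hA]
  calc _ ≤ A * (Real.exp 1 * (4 * (4 / κ ^ 2) ^ 3) * t / m ^ 3 * J) := by gcongr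
    _ = A * (Real.exp 1 * (4 * (4 / κ ^ 2) ^ 3) * J) * t / m ^ 3 := by ring
    _ ≤ _ := by gcongr; linarith

/-! ### Pointwise bounds for the kernel -/

theorem abs_inner_S2_le_one (x y : S2) :
    |inner ℝ (x : EuclideanSpace ℝ (Fin 3)) (y : EuclideanSpace ℝ (Fin 3))| ≤ 1 := by
  have h := abs_real_inner_le_norm (x : EuclideanSpace ℝ (Fin 3)) y
  rwa [norm_eq_of_mem_sphere, norm_eq_of_mem_sphere, one_mul] at h

theorem dist_sq_eq (x y : S2) : dist x y ^ 2 =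
    2 * (1 - inner ℝ (x : EuclideanSpace ℝ (Fin 3)) (y : EuclideanSpace ℝ (Fin 3))) := by
  rw [Subtype.dist_eq, dist_eq_norm, norm_sub_sq_real, norm_eq_of_mem_sphere,
    norm_eq_of_mem_sphere]
  ring

theorem dist_le_geodesicDist (x y : S2) : dist x y ≤ geodesicDist x y := by
  have h := abs_le.1 (abs_inner_S2_le_one x y)
  have h0 : 0 ≤ geodesicDist x y := Real.arccos_nonneg _
  have h1 := Real.one_sub_sq_div_two_le_cos (x := geodesicDist x y)
  rw [geodesicDist, Real.cos_arccos h.1 h.2, ← geodesicDist] at h1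
  refine (sq_le_sq₀ dist_nonneg h0).1 ?_
  rw [dist_sq_eq]
  linarith

theorem weight_nonneg (s : ℕ) (x : ℝ) : 0 ≤ weight s x := by
  rw [weight, pow_mul]; positivity

theorem summable_weight (s : ℕ) {t : ℝ} (ht : 0 < t) :
    Summable fun l : ℕ => weight s (l * t) * (2 * (l : ℝ) + 1) := by
  have hr : ‖Real.exp (-t ^ 2)‖ < 1 := by
    rw [Real.norm_of_nonneg (Real.exp_pos _).le, Real.exp_lt_one_iff]
    have := pow_pos ht 2
    linarith
  have h (k : ℕ) := summable_pow_mul_geometric_of_norm_lt_one k hr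
  refine ((((h (2 * s + 1)).mul_left 2).add (h (2 * s))).mul_left (t ^ (2 * s))).of_nonneg_of_le
    (fun l => mul_nonneg (weight_nonneg _ _) (by positivity)) fun l => ?_
  have h1 : Real.exp (-((l : ℝ) * t) ^ 2) ≤ Real.exp (-t ^ 2) ^ l := by
    rw [← Real.exp_nat_mul]
    apply Real.exp_le_exp.2
    have : (l : ℝ) ≤ (l : ℝ) ^ 2 := by
      exact_mod_cast Nat.le_self_pow (by norm_num) l
    have := mul_le_mul_of_nonneg_right this (sq_nonneg t)
    linarith [mul_pow (l : ℝ) t 2]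
  calc weight s (l * t) * (2 * (l : ℝ) + 1)
      = t ^ (2 * s) * (l : ℝ) ^ (2 * s) * (2 * l + 1) * Real.exp (-((l : ℝ) * t) ^ 2) := by
        rw [weight, mul_pow]; ring
    _ ≤ t ^ (2 * s) * (l : ℝ) ^ (2 * s) * (2 * l + 1) * Real.exp (-t ^ 2) ^ l := by gcongr
    _ = _ := by ring

/-- The series `∑ f_s(l t) (2 l + 1) P_l(x)`, which is `4 π` times the kernel with `t = B ^ (-j)` at
two points of inner product `x`. -/
def kernelSeries (s : ℕ) (t x : ℝ) : ℝ :=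
  ∑' l : ℕ, weight s (l * t) * (2 * (l : ℝ) + 1) * (legendreP l).eval x

theorem summable_kernelSeries (s : ℕ) {t x : ℝ} (ht : 0 < t) (hx : |x| ≤ 1) :
    Summable fun l : ℕ => weight s (l * t) * (2 * (l : ℝ) + 1) * (legendreP l).eval x := by
  refine (summable_weight s ht).of_norm_bounded fun l => ?_
  have h0 : 0 ≤ weight s (l * t) * (2 * (l : ℝ) + 1) :=
    mul_nonneg (weight_nonneg _ _) (by positivity)
  rw [norm_mul, Real.norm_of_nonneg h0]
  exact mul_le_of_le_one_right h0 (abs_legendreP_le_one hx l)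

theorem kernelTerm_eq (B : ℝ) (j : ℤ) (s : ℕ) (x y : S2) (l : ℕ) :
    kernelTerm B j s x y l = (1 / (4 * Real.pi)) * (weight s (l * B ^ (-j)) * (2 * (l : ℝ) + 1) *
      (legendreP l).eval (inner ℝ (x : EuclideanSpace ℝ (Fin 3)) y)) := by
  rw [kernelTerm, zpow_neg, ← div_eq_mul_inv]; ring

theorem kernel_eq (B : ℝ) (j : ℤ) (s : ℕ) (x y : S2) : kernel B j s x y = (1 / (4 * Real.pi)) *
    kernelSeries s (B ^ (-j)) (inner ℝ (x : EuclideanSpace ℝ (Fin 3)) y) := by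
  simp only [kernel, kernelSeries, kernelTerm_eq, tsum_mul_left]

theorem summable_kernelTerm {B : ℝ} (hB : 0 < B) (j : ℤ) (s : ℕ) (x y : S2) :
    Summable (kernelTerm B j s x y) := by
  refine ((summable_kernelSeries s (zpow_pos hB (-j)) (abs_inner_S2_le_one x y)).mul_left
    (1 / (4 * Real.pi))).congr fun l => (kernelTerm_eq B j s x y l).symm

theorem continuous_kernel {B : ℝ} (hB : 0 < B) (j : ℤ) (s : ℕ) (y : S2) :
    Continuous fun x => kernel B j s x y := by
  refine continuous_tsum (fun l => ?_)
    ((summable_weight s (zpow_pos hB (-j))).mul_left (1 / (4 * Real.pi))) fun l x => ?_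
  · unfold kernelTerm
    exact continuous_const.mul ((legendreP l).continuous.comp (by fun_prop))
  · have h0 : 0 ≤ (1 / (4 * Real.pi)) * (weight s (l * B ^ (-j)) * (2 * (l : ℝ) + 1)) :=
      mul_nonneg (by positivity) (mul_nonneg (weight_nonneg _ _) (by positivity))
    rw [kernelTerm_eq, ← mul_assoc, norm_mul, Real.norm_of_nonneg h0]
    exact mul_le_of_le_one_right h0 (abs_legendreP_le_one (abs_inner_S2_le_one x y) l)

/-- On the diagonal the kernel series is at least of order `t ^ (-2)`: about `1 / t` of its terms,
those with `l t` between `1` and `2 + 2 T`, are of order `1 / t`. -/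
theorem exists_le_kernelSeries_one (s : ℕ) (T : ℝ) : ∃ c : ℝ, 0 < c ∧
    ∀ t : ℝ, 0 < t → t ≤ T → c / t ^ 2 ≤ kernelSeries s t 1 := by
  refine ⟨2 * Real.exp (-(2 + 2 * T) ^ 2), by positivity, fun t ht htT => ?_⟩
  set n := ⌈1 / t⌉₊ with hn
  have hn1 : 1 / t ≤ n := Nat.le_ceil _
  have hn2 : (n : ℝ) < 1 / t + 1 := Nat.ceil_lt_add_one (by positivity)
  have hnt : 1 ≤ n * t := by rwa [div_le_iff₀ ht] at hn1
  have hnt2 : n * t ≤ 1 + T := by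
    have := mul_lt_mul_of_pos_right hn2 ht
    rw [add_mul, one_div, inv_mul_cancel₀ ht.ne'] at this
    linarith
  have hterm (l : ℕ) (hl : l ∈ Finset.Ico n (2 * n)) : Real.exp (-(2 + 2 * T) ^ 2) * (2 * n) ≤
      weight s (l * t) * (2 * (l : ℝ) + 1) * (legendreP l).eval 1 := by
    obtain ⟨h1, h2⟩ := Finset.mem_Ico.1 hl
    have h1' : (n : ℝ) ≤ l := by exact_mod_cast h1
    have h2' : (l : ℝ) ≤ 2 * n := by exact_mod_cast h2.le
    have hl1 : 1 ≤ l * t := hnt.trans (by gcongr)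
    have hl2 : l * t ≤ 2 + 2 * T := by
      have := mul_le_mul_of_nonneg_right h2' ht.le
      linarith
    rw [legendreP_one, mul_one, weight]
    have h3 : Real.exp (-(2 + 2 * T) ^ 2) ≤ (l * t) ^ (2 * s) * Real.exp (-(l * t) ^ 2) := by
      refine le_trans ?_ (le_mul_of_one_le_left (Real.exp_pos _).le (one_le_pow₀ hl1))
      apply Real.exp_le_exp.2
      have : (l * t) ^ 2 ≤ (2 + 2 * T) ^ 2 := by gcongr
      linarith
    exact mul_le_mul h3 (by linarith) (by positivity) (by positivity)
  have hsum := (summable_kernelSeries s ht (x := 1) (by simp)).sum_le_tsum (Finset.Ico n (2 * n))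
    fun l _ => by
      rw [legendreP_one, mul_one]; exact mul_nonneg (weight_nonneg _ _) (by positivity)
  refine le_trans ?_ hsum
  refine le_trans ?_ (Finset.card_nsmul_le_sum _ _ _ hterm)
  rw [Nat.card_Ico, show 2 * n - n = n by omega, nsmul_eq_mul]
  have h4 : 1 / t ^ 2 ≤ (n : ℝ) ^ 2 := by
    rw [← one_div_pow]; gcongr
  calc 2 * Real.exp (-(2 + 2 * T) ^ 2) / t ^ 2 = 2 * Real.exp (-(2 + 2 * T) ^ 2) * (1 / t ^ 2) := by
        ring
    _ ≤ 2 * Real.exp (-(2 + 2 * T) ^ 2) * (n : ℝ) ^ 2 := by gcongr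
    _ = _ := by ring

/-- Since `1 - P_l(x) ≤ l ^ 2 (1 - x)` and `(l t) ^ 2 f_s(l t) = f_{s+1}(l t)`, the oscillation of
the kernel near the diagonal is controlled by the diagonal values of the next kernel. -/
theorem kernelSeries_one_sub_le (s : ℕ) {t x : ℝ} (ht : 0 < t) (hx : |x| ≤ 1) :
    kernelSeries s t 1 - kernelSeries s t x ≤ (1 - x) / t ^ 2 * kernelSeries (s + 1) t 1 := by
  have s1 := summable_kernelSeries s ht (x := 1) (by simp)
  have s2 := summable_kernelSeries s ht hx
  have s3 := summable_kernelSeries (s + 1) ht (x := 1) (by simp)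
  rw [kernelSeries, kernelSeries, kernelSeries, ← s1.tsum_sub s2, ← tsum_mul_left]
  refine (s1.sub s2).tsum_le_tsum (fun l => ?_) (s3.mul_left _)
  have h := one_sub_legendreP_le hx l
  have h0 : 0 ≤ weight s (l * t) * (2 * (l : ℝ) + 1) :=
    mul_nonneg (weight_nonneg _ _) (by positivity)
  have h1 := mul_le_mul_of_nonneg_left h h0
  have h2 : weight (s + 1) (l * t) = (l : ℝ) ^ 2 * t ^ 2 * weight s (l * t) := by
    rw [weight, weight]; ring
  rw [legendreP_one, h2]
  calc _ = weight s (l * t) * (2 * (l : ℝ) + 1) * (1 - (legendreP l).eval x) := by ring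
    _ ≤ _ := h1
    _ = _ := by field_simp

theorem exists_kernel_le {B : ℝ} (hB : 0 < B) (s : ℕ) {T : ℝ} (hT : 0 < T) : ∃ C : ℝ, 0 < C ∧
    ∀ j : ℤ, B ^ (-j) ≤ T → ∀ x y : S2,
      |kernel B j s x y| ≤ C * (B ^ (-j) / max (B ^ (-j)) (dist x y) ^ 3) := by
  obtain ⟨C, hC, h⟩ := exists_kernelSeries_le s hT
  refine ⟨C, hC, fun j hj x y => ?_⟩
  have ht : 0 < B ^ (-j) := zpow_pos hB _
  have hm : 0 < max (B ^ (-j)) (dist x y) := lt_max_of_lt_left ht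
  have h1 := h _ ht hj _ (abs_inner_S2_le_one x y) _ hm (by
    rw [← dist_sq_eq]
    rcases max_choice (B ^ (-j)) (dist x y) with h | h <;> rw [h]
    · exact le_max_left _ _
    · exact le_max_right _ _)
  rw [kernel_eq, abs_mul, abs_of_pos (by positivity), ← mul_div_assoc]
  refine le_trans (mul_le_of_le_one_left (abs_nonneg _) ?_) h1
  rw [div_le_one (by positivity)]
  linarith [Real.pi_gt_three]

theorem exists_le_kernel {B : ℝ} (hB : 0 < B) (s : ℕ) {T : ℝ} (hT : 0 < T) :
    ∃ c δ : ℝ, 0 < c ∧ 0 < δ ∧ ∀ j : ℤ, B ^ (-j) ≤ T → ∀ x y : S2, dist x y ≤ δ * B ^ (-j) →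
      c / (B ^ (-j)) ^ 2 ≤ kernel B j s x y := by
  obtain ⟨C, hC, hup⟩ := exists_kernelSeries_le (s + 1) hT
  obtain ⟨c, hc, hlow⟩ := exists_le_kernelSeries_one s T
  -- `δ ^ 2 = c / C` makes the drop from the diagonal at most half of the diagonal value
  refine ⟨1 / (4 * Real.pi) * (c / 2), √(c / C), by positivity, by positivity,
    fun j hj x y hxy => ?_⟩
  have ht : 0 < B ^ (-j) := zpow_pos hB _
  set t := B ^ (-j)
  have h1 := (le_abs_self _).trans (hup t ht hj 1 (by simp) t ht (le_max_left _ _))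
  have h2 := hlow t ht hj
  have h3 := kernelSeries_one_sub_le s ht (abs_inner_S2_le_one x y)
  have hd : dist x y ^ 2 ≤ c / C * t ^ 2 := by
    have := pow_le_pow_left₀ dist_nonneg hxy 2
    rwa [mul_pow, Real.sq_sqrt (by positivity)] at this
  rw [dist_sq_eq] at hd
  rw [kernel_eq, mul_div_assoc]
  gcongr
  set u := inner ℝ (x : EuclideanSpace ℝ (Fin 3)) (y : EuclideanSpace ℝ (Fin 3))
  have hu : 0 ≤ 1 - u := by have := (abs_le.1 (abs_inner_S2_le_one x y)).2; linarith
  have h4 : (1 - u) / t ^ 2 * kernelSeries (s + 1) t 1 ≤ c / 2 / t ^ 2 := by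
    have h5 : 1 - u ≤ c / C * t ^ 2 / 2 := by linarith
    calc _ ≤ (1 - u) / t ^ 2 * (C * t / t ^ 3) :=
          mul_le_mul_of_nonneg_left h1 (by positivity)
      _ ≤ (c / C * t ^ 2 / 2) / t ^ 2 * (C * t / t ^ 3) := by gcongr
      _ = _ := by field_simp
  have h5 : c / t ^ 2 = c / 2 / t ^ 2 + c / 2 / t ^ 2 := by ring
  linarith

/-! ### Areas of spherical caps -/

instance : IsFiniteMeasure area := by unfold area; infer_instance

/-- The volume of the unit ball of `ℝ³`. -/
def ballVolume : ℝ := (volume : Measure (EuclideanSpace ℝ (Fin 3))).real (Metric.ball 0 1)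

theorem ballVolume_pos : 0 < ballVolume :=
  ENNReal.toReal_pos (Metric.measure_ball_pos _ _ one_pos).ne' measure_ball_lt_top.ne

theorem volume_real_ball (x : EuclideanSpace ℝ (Fin 3)) {r : ℝ} (hr : 0 < r) :
    (volume : Measure (EuclideanSpace ℝ (Fin 3))).real (Metric.ball x r) = r ^ 3 * ballVolume := by
  rw [Measure.real, Measure.addHaar_ball_of_pos _ _ hr, ENNReal.toReal_mul,
    ENNReal.toReal_ofReal (by positivity)]
  simp [ballVolume, Measure.real]

open scoped Pointwise in
/-- The truncated cone `{r x | 0 < r < 1, x ∈ s}` over a subset `s` of the unit sphere. -/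
def cone (s : Set S2) : Set (EuclideanSpace ℝ (Fin 3)) :=
  Set.Ioo (0 : ℝ) 1 • ((↑) '' s : Set (EuclideanSpace ℝ (Fin 3)))

theorem area_real_eq {s : Set S2} (hs : MeasurableSet s) :
    area.real s = 3 * (volume : Measure (EuclideanSpace ℝ (Fin 3))).real (cone s) := by
  rw [Measure.real, area, Measure.toSphere_apply' _ hs, ENNReal.toReal_mul]
  simp [cone, Measure.real]

theorem cone_subset_ball (s : Set S2) : cone s ⊆ Metric.ball 0 1 := by
  rintro _ ⟨r, hr, _, ⟨x, -, rfl⟩, rfl⟩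
  simp [norm_smul, abs_of_pos hr.1, hr.2]

theorem area_real_le_const (s : Set S2) : area.real s ≤ 3 * ballVolume := by
  refine (measureReal_mono (Set.subset_univ s)).trans ?_
  rw [area_real_eq MeasurableSet.univ]
  exact mul_le_mul_of_nonneg_left
    (measureReal_mono (cone_subset_ball _) measure_ball_lt_top.ne) (by norm_num)

/-- The cone over a cap of radius `ρ` is covered by about `1 / ρ` balls of radius `3 ρ` centred on
its axis. -/
theorem area_closedBall_le (ξ : S2) {ρ : ℝ} (hρ : 0 < ρ) :
    area.real (Metric.closedBall ξ ρ) ≤ 300 * ballVolume * ρ ^ 2 := by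
  have hV := ballVolume_pos
  -- for `ρ ≥ 1` the area of the whole sphere is a sufficient bound
  rcases le_total 1 ρ with h1 | h1
  · refine (area_real_le_const _).trans ?_
    have : 1 ≤ ρ ^ 2 := one_le_pow₀ h1
    nlinarith
  rw [area_real_eq Metric.isClosed_closedBall.measurableSet]
  set n := ⌈1 / ρ⌉₊
  have hsub : cone (Metric.closedBall ξ ρ) ⊆ ⋃ k ∈ Finset.range (n + 1),
      Metric.ball (((k : ℝ) * ρ) • (ξ : EuclideanSpace ℝ (Fin 3))) (3 * ρ) := by
    rintro _ ⟨r, hr, _, ⟨x, hx, rfl⟩, rfl⟩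
    have hr0 : 0 ≤ r / ρ := div_nonneg hr.1.le hρ.le
    have hf1 := Nat.floor_le hr0
    have hf2 := Nat.lt_floor_add_one (r / ρ)
    rw [le_div_iff₀ hρ] at hf1
    rw [div_lt_iff₀ hρ] at hf2
    have hk : ⌊r / ρ⌋₊ < n + 1 := by
      refine Nat.lt_succ_of_le ((Nat.floor_le_floor ?_).trans (Nat.floor_le_ceil _))
      exact div_le_div_of_nonneg_right hr.2.le hρ.le
    simp only [Set.mem_iUnion, Finset.mem_range]
    refine ⟨⌊r / ρ⌋₊, hk, ?_⟩
    set q : ℝ := (⌊r / ρ⌋₊ : ℝ) * ρ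
    rw [Metric.mem_closedBall, Subtype.dist_eq, dist_eq_norm] at hx
    rw [Metric.mem_ball, dist_eq_norm]
    have : r • (x : EuclideanSpace ℝ (Fin 3)) - q • (ξ : EuclideanSpace ℝ (Fin 3)) =
        r • ((x : EuclideanSpace ℝ (Fin 3)) - ξ) + (r - q) • (ξ : EuclideanSpace ℝ (Fin 3)) := by
      module
    simp only [this]
    refine (norm_add_le _ _).trans_lt ?_
    rw [norm_smul, norm_smul, norm_eq_of_mem_sphere, mul_one, Real.norm_of_nonneg hr.1.le,
      Real.norm_of_nonneg (by linarith)]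
    have h2 := mul_le_of_le_one_left (norm_nonneg ((x : EuclideanSpace ℝ (Fin 3)) - ξ)) hr.2.le
    have h3 : r - q < ρ := by
      rw [add_mul, one_mul] at hf2
      linarith
    linarith
  have hvol : (volume : Measure (EuclideanSpace ℝ (Fin 3))).real (cone (Metric.closedBall ξ ρ)) ≤
      (n + 1) * ((3 * ρ) ^ 3 * ballVolume) := by
    refine (measureReal_mono hsub ?_).trans ((measureReal_biUnion_finset_le _ _).trans ?_)
    · exact ((measure_biUnion_lt_top (Finset.finite_toSet _) fun k _ => measure_ball_lt_top)).ne
    · simp [volume_real_ball _ (by positivity : 0 < 3 * ρ)]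
  have hn : (n : ℝ) < 1 / ρ + 1 := Nat.ceil_lt_add_one (by positivity)
  have hn2 : ((n : ℝ) + 1) * ρ ≤ 3 := by
    have := mul_lt_mul_of_pos_right hn hρ
    rw [add_mul, one_div, inv_mul_cancel₀ hρ.ne'] at this
    linarith
  calc _ ≤ 3 * ((n + 1) * ((3 * ρ) ^ 3 * ballVolume)) := by gcongr
    _ = 81 * ballVolume * ρ ^ 2 * ((n + 1) * ρ) := by ring
    _ ≤ 81 * ballVolume * ρ ^ 2 * 3 := by gcongr
    _ ≤ _ := by nlinarith [mul_nonneg hV.le (sq_nonneg ρ)]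

theorem ball_subset_cone (ξ : S2) {ρ c : ℝ} (hρ : 0 < ρ) (hρ1 : ρ ≤ 1) (hc : 1 / 2 ≤ c)
    (hc1 : c + ρ / 8 ≤ 1) :
    Metric.ball (c • (ξ : EuclideanSpace ℝ (Fin 3))) (ρ / 8) ⊆ cone (Metric.closedBall ξ ρ) := by
  intro y hy
  rw [Metric.mem_ball, dist_eq_norm] at hy
  have hcξ : ‖c • (ξ : EuclideanSpace ℝ (Fin 3))‖ = c := by
    rw [norm_smul, norm_eq_of_mem_sphere, mul_one, Real.norm_of_nonneg (by linarith)]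
  have habs : |‖y‖ - c| < ρ / 8 := by
    have := abs_norm_sub_norm_le y (c • (ξ : EuclideanSpace ℝ (Fin 3)))
    rw [hcξ] at this
    linarith
  obtain ⟨ha1, ha2⟩ := abs_lt.1 habs
  have hy0 : 3 / 8 ≤ ‖y‖ := by linarith
  have hypos : 0 < ‖y‖ := by linarith
  have hu : ‖(‖y‖⁻¹ • y)‖ = 1 := by
    rw [norm_smul, norm_inv, norm_norm, inv_mul_cancel₀ hypos.ne']
  refine ⟨‖y‖, ⟨hypos, by linarith⟩, ‖y‖⁻¹ • y, ⟨⟨‖y‖⁻¹ • y, by simpa using hu⟩, ?_, rfl⟩, ?_⟩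
  · rw [Metric.mem_closedBall, Subtype.dist_eq, dist_eq_norm]
    have h1 : ‖y‖ • (‖y‖⁻¹ • y - (ξ : EuclideanSpace ℝ (Fin 3))) =
        (y - c • (ξ : EuclideanSpace ℝ (Fin 3))) - (‖y‖ - c) • (ξ : EuclideanSpace ℝ (Fin 3)) := by
      rw [smul_sub, smul_smul, mul_inv_cancel₀ hypos.ne']
      module
    have h2 := congrArg norm h1
    rw [norm_smul, norm_norm] at h2
    have h3 := norm_sub_le (y - c • (ξ : EuclideanSpace ℝ (Fin 3)))
      ((‖y‖ - c) • (ξ : EuclideanSpace ℝ (Fin 3)))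
    rw [norm_smul, norm_eq_of_mem_sphere, mul_one, Real.norm_eq_abs] at h3
    set z := ‖‖y‖⁻¹ • y - (ξ : EuclideanSpace ℝ (Fin 3))‖
    have h4 : 3 / 8 * z ≤ ‖y‖ * z := by gcongr
    change z ≤ ρ
    linarith
  · simp [smul_smul, mul_inv_cancel₀ hypos.ne']

/-- The cone over a cap of radius `ρ` contains about `1 / ρ` disjoint balls of radius `ρ / 8`
centred on its axis. -/
theorem le_area_closedBall (ξ : S2) {ρ : ℝ} (hρ : 0 < ρ) (hρ1 : ρ ≤ 1) :
    ballVolume / 1024 * ρ ^ 2 ≤ area.real (Metric.closedBall ξ ρ) := by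
  have hV := ballVolume_pos
  rw [area_real_eq Metric.isClosed_closedBall.measurableSet]
  set n := ⌈1 / (2 * ρ)⌉₊
  have hn : (n : ℝ) < 1 / (2 * ρ) + 1 := Nat.ceil_lt_add_one (by positivity)
  have hn' : 1 / (2 * ρ) ≤ n := Nat.le_ceil _
  set b : ℕ → Set (EuclideanSpace ℝ (Fin 3)) := fun k =>
    Metric.ball ((1 / 2 + (k : ℝ) * ρ / 2) • (ξ : EuclideanSpace ℝ (Fin 3))) (ρ / 8)
  have hsub : (⋃ k ∈ Finset.range n, b k) ⊆ cone (Metric.closedBall ξ ρ) := by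
    refine Set.iUnion₂_subset fun k hk => ball_subset_cone ξ hρ hρ1 ?_ ?_
    · have : 0 ≤ (k : ℝ) * ρ := by positivity
      linarith
    · have hk1 : (k : ℝ) + 1 ≤ n := by exact_mod_cast Finset.mem_range.1 hk
      have hk2 : (k : ℝ) < 1 / (2 * ρ) := by linarith
      rw [lt_div_iff₀ (by positivity)] at hk2
      linarith
  have hdisj : Set.PairwiseDisjoint (Finset.range n : Set ℕ) b := by
    intro k _ l _ hkl
    apply Metric.ball_disjoint_ball
    rw [dist_eq_norm, ← sub_smul, norm_smul, norm_eq_of_mem_sphere, mul_one, Real.norm_eq_abs]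
    have h1 : (1 : ℝ) ≤ |(k : ℝ) - l| := by
      have : (1 : ℤ) ≤ |(k : ℤ) - l| := Int.one_le_abs (by omega)
      exact_mod_cast this
    have h2 : 1 / 2 + (k : ℝ) * ρ / 2 - (1 / 2 + (l : ℝ) * ρ / 2) = ((k : ℝ) - l) * (ρ / 2) := by
      ring
    rw [h2, abs_mul, abs_of_pos (by positivity : 0 < ρ / 2)]
    nlinarith
  have hvol : n * ((ρ / 8) ^ 3 * ballVolume) ≤
      (volume : Measure (EuclideanSpace ℝ (Fin 3))).real (cone (Metric.closedBall ξ ρ)) := by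
    have h1 := measureReal_mono (μ := (volume : Measure (EuclideanSpace ℝ (Fin 3)))) hsub
      ((measure_mono (cone_subset_ball _)).trans_lt measure_ball_lt_top).ne
    rw [measureReal_biUnion_finset hdisj (fun _ _ => measurableSet_ball)
      (fun _ _ => measure_ball_lt_top.ne)] at h1
    simpa [b, volume_real_ball _ (by positivity : 0 < ρ / 8)] using h1
  calc ballVolume / 1024 * ρ ^ 2 = 1 / (2 * ρ) * ((ρ / 8) ^ 3 * ballVolume) := by
        field_simp; norm_num
    _ ≤ n * ((ρ / 8) ^ 3 * ballVolume) := by gcongr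
    _ ≤ _ := hvol
    _ ≤ _ := le_mul_of_one_le_left measureReal_nonneg (by norm_num)

/-- The localisation profile `t / max(t, d) ^ 3` has bounded integral: the cap of radius
`2 ^ (k + 1) t` contributes `O(2 ^ (-k))`. -/
theorem lintegral_profile_le (ξ : S2) {t : ℝ} (ht : 0 < t) :
    ∫⁻ x, ENNReal.ofReal (t / max t (dist x ξ) ^ 3) ∂area ≤
      ENNReal.ofReal (2400 * ballVolume) := by
  have hV := ballVolume_pos
  set b : ℕ → Set S2 := fun k => Metric.closedBall ξ (2 ^ (k + 1) * t)
  have hb (k : ℕ) : MeasurableSet (b k) := Metric.isClosed_closedBall.measurableSet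
  have hle (x : S2) : ENNReal.ofReal (t / max t (dist x ξ) ^ 3) ≤
      ∑' k, (b k).indicator (fun _ => ENNReal.ofReal (t / (2 ^ k * t) ^ 3)) x := by
    set m := max t (dist x ξ)
    obtain ⟨k, hk1, hk2⟩ := exists_nat_pow_near (x := m / t) (y := 2)
      ((one_le_div ht).2 (le_max_left _ _)) one_lt_two
    rw [le_div_iff₀ ht] at hk1
    rw [div_lt_iff₀ ht] at hk2
    refine le_trans ?_ (ENNReal.le_tsum k)
    rw [Set.indicator_of_mem]
    · apply ENNReal.ofReal_le_ofReal
      gcongr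
    · exact Metric.mem_closedBall.2 ((le_max_right _ _).trans hk2.le)
  calc _ ≤ ∫⁻ x, ∑' k, (b k).indicator (fun _ => ENNReal.ofReal (t / (2 ^ k * t) ^ 3)) x ∂area :=
        lintegral_mono hle
    _ = ∑' k, ENNReal.ofReal (t / (2 ^ k * t) ^ 3) * area (b k) := by
        rw [lintegral_tsum fun k => (measurable_const.indicator (hb k)).aemeasurable]
        simp_rw [lintegral_indicator_const (hb _)]
    _ ≤ ∑' k : ℕ, ENNReal.ofReal (1200 * ballVolume * (1 / 2) ^ k) := by
        refine ENNReal.tsum_le_tsum fun k => ?_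
        rw [← ofReal_measureReal (measure_ne_top area _), ← ENNReal.ofReal_mul (by positivity)]
        apply ENNReal.ofReal_le_ofReal
        calc _ ≤ t / (2 ^ k * t) ^ 3 * (300 * ballVolume * (2 ^ (k + 1) * t) ^ 2) := by
              gcongr
              exact area_closedBall_le ξ (by positivity)
          _ = _ := by
              rw [one_div, inv_pow]
              field_simp
              ring
    _ = ENNReal.ofReal (2400 * ballVolume) := by
        rw [← ENNReal.ofReal_tsum_of_nonneg (fun k => by positivity)
          (summable_geometric_two.mul_left _), tsum_mul_left, tsum_geometric_two]
        congr 1; ring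

/-! ### From pointwise bounds to `L^p` norms -/

/-- A function of height at most `A / t` and of `L¹` norm at most `D t` has `L^p` norm at most of
order `t ^ (2 / p - 1)`, as `|f| ^ p ≤ (A / t) ^ (p - 1) |f|`. -/
theorem eLpNorm_le_of_bound {f : S2 → ℝ} {A D t p : ℝ} (hA : 0 < A) (hD : 0 < D)
    (ht : 0 < t) (hp : 1 ≤ p) (hf : ∀ x, |f x| ≤ A / t)
    (hint : ∫⁻ x, ‖f x‖ₑ ∂area ≤ ENNReal.ofReal (D * t)) :
    eLpNorm f (ENNReal.ofReal p) area ≤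
      ENNReal.ofReal ((A ^ (p - 1) * D) ^ (1 / p) * t ^ (2 / p - 1)) := by
  have hp0 : 0 < p := by linarith
  have hp1 : 0 ≤ p - 1 := by linarith
  rw [eLpNorm_eq_lintegral_rpow_enorm_toReal (by simpa using hp0) ENNReal.ofReal_ne_top,
    ENNReal.toReal_ofReal hp0.le]
  have h1 (x : S2) : ‖f x‖ₑ ^ p ≤ ENNReal.ofReal ((A / t) ^ (p - 1)) * ‖f x‖ₑ := by
    have h2 : ‖f x‖ₑ ^ p = ‖f x‖ₑ ^ (p - 1) * ‖f x‖ₑ := by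
      conv_lhs => rw [show p = (p - 1) + 1 by ring]
      rw [ENNReal.rpow_add_of_nonneg _ _ hp1 zero_le_one, ENNReal.rpow_one]
    rw [h2, ← ENNReal.ofReal_rpow_of_nonneg (by positivity) hp1]
    gcongr
    rw [Real.enorm_eq_ofReal_abs]
    exact ENNReal.ofReal_le_ofReal (hf x)
  have h2 : ∫⁻ x, ‖f x‖ₑ ^ p ∂area ≤ ENNReal.ofReal ((A / t) ^ (p - 1) * (D * t)) := by
    rw [ENNReal.ofReal_mul (by positivity)]
    refine (lintegral_mono h1).trans ?_
    rw [lintegral_const_mul' _ _ ENNReal.ofReal_ne_top]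
    gcongr
  refine (ENNReal.rpow_le_rpow h2 (by positivity)).trans (le_of_eq ?_)
  rw [ENNReal.ofReal_rpow_of_nonneg (by positivity) (by positivity)]
  congr 1
  have h3 : (A / t) ^ (p - 1) * (D * t) = (A ^ (p - 1) * D) * t ^ (2 - p) := by
    have h4 : t ^ (2 - p) = t / t ^ (p - 1) := by
      rw [show 2 - p = 1 - (p - 1) by ring, Real.rpow_sub ht 1, Real.rpow_one]
    rw [Real.div_rpow hA.le ht.le, h4]
    ring
  rw [h3, Real.mul_rpow (by positivity) (by positivity), ← Real.rpow_mul ht.le]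
  congr 2
  field_simp

/-- A function of height at least `a / t` on a set of area at least `b t ^ 2` has `L^p` norm at
least of order `t ^ (2 / p - 1)`; for `p = ∞`, whose `toReal` is `0`, the quotient `2 / 0 = 0` gives
the right exponent `-1`. -/
theorem le_eLpNorm_of_bound {f : S2 → ℝ} {a b t : ℝ} {p : ℝ≥0∞} (ha : 0 < a) (hb : 0 < b)
    (ht : 0 < t) (hp : p ≠ 0) {S : Set S2} (hS : MeasurableSet S)
    (hbS : b * t ^ 2 ≤ area.real S) (hf : ∀ x ∈ S, a / t ≤ f x) :
    ENNReal.ofReal (a * b ^ (1 / p.toReal) * t ^ (2 / p.toReal - 1)) ≤ eLpNorm f p area := by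
  have hbt : 0 < b * t ^ 2 := by positivity
  have hSarea : ENNReal.ofReal (b * t ^ 2) ≤ area S := by
    rw [← ofReal_measureReal (measure_ne_top area S)]
    exact ENNReal.ofReal_le_ofReal hbS
  have hS0 : area S ≠ 0 := ((ENNReal.ofReal_pos.2 hbt).trans_le hSarea).ne'
  have h1 : eLpNorm (S.indicator fun _ => a / t) p area ≤ eLpNorm f p area := by
    refine eLpNorm_mono fun x => ?_
    by_cases hx : x ∈ S
    · rw [Set.indicator_of_mem hx, Real.norm_of_nonneg (by positivity)]
      exact (hf x hx).trans (le_abs_self _)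
    · rw [Set.indicator_of_notMem hx, norm_zero]
      exact norm_nonneg _
  refine le_trans ?_ h1
  rw [eLpNorm_indicator_const' hS hS0 hp, Real.enorm_eq_ofReal_abs, abs_of_pos (by positivity)]
  have hp' : 0 ≤ 1 / p.toReal := by positivity
  calc _ = ENNReal.ofReal (a / t) * ENNReal.ofReal (b * t ^ 2) ^ (1 / p.toReal) := by
        rw [ENNReal.ofReal_rpow_of_nonneg hbt.le hp', ← ENNReal.ofReal_mul (by positivity)]
        congr 1
        rw [Real.mul_rpow hb.le (by positivity), ← Real.rpow_natCast t 2, ← Real.rpow_mul ht.le,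
          Real.rpow_sub ht, Real.rpow_one]
        push_cast
        ring_nf
    _ ≤ _ := by gcongr

/-- At every level that admits a partition the needlets have height of order `1 / t`, with
`t = B ^ (-j)`, attained on a set of area of order `t ^ 2`, and their `L¹` norm is at most of
order `t`. The area bound for the regions makes such `t` bounded. -/
theorem exists_needlet_bounds {B : ℝ} (hB : 0 < B) (s : ℕ) {cB cB' : ℝ} (hcB : 0 < cB)
    (hcB' : 0 < cB') : ∃ A D a b : ℝ, 0 < A ∧ 0 < D ∧ 0 < a ∧ 0 < b ∧
    ∀ (j : ℤ) (N : ℕ) (E : Fin N → Set S2) (ξ : Fin N → S2), IsPartition B cB cB' j E ξ →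
      ∀ k : Fin N,
        (∀ x, |needlet B j s E ξ k x| ≤ A / B ^ (-j)) ∧
        (∫⁻ x, ‖needlet B j s E ξ k x‖ₑ ∂area ≤ ENNReal.ofReal (D * B ^ (-j))) ∧
        ∃ S : Set S2, MeasurableSet S ∧ b * (B ^ (-j)) ^ 2 ≤ area.real S ∧
          ∀ x ∈ S, a / B ^ (-j) ≤ needlet B j s E ξ k x := by
  have hV := ballVolume_pos
  set T : ℝ := √(3 * ballVolume / cB')
  have hT : 0 < T := Real.sqrt_pos.2 (by positivity)
  obtain ⟨C, hC, hup⟩ := exists_kernel_le hB s hT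
  obtain ⟨c, δ, hc, hδ, hlow⟩ := exists_le_kernel hB s hT
  set L : ℝ := √(300 * ballVolume) * cB
  have hL : 0 < L := by positivity
  -- the second argument of `min` keeps the radius `ρ t` of the lower-bound cap at most `1`
  set ρ : ℝ := min δ (1 / T)
  have hρ : 0 < ρ := lt_min hδ (by positivity)
  refine ⟨L * C, L * C * (2400 * ballVolume), √cB' * c, ballVolume / 1024 * ρ ^ 2,
    by positivity, by positivity, by positivity, by positivity, fun j N E ξ hE k => ?_⟩
  have ht : 0 < B ^ (-j) := zpow_pos hB _
  have hlam := hE.le_area k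
  rw [show B ^ (-2 * j) = (B ^ (-j)) ^ 2 by rw [← zpow_natCast, ← zpow_mul]; congr 1; ring] at hlam
  have hdiam (x : S2) (hx : x ∈ E k) : dist x (ξ k) ≤ cB * B ^ (-j) :=
    (dist_le_geodesicDist _ _).trans (hE.diam_le k x hx _ (hE.point_mem k))
  set t := B ^ (-j) with htdef
  have htT : t ≤ T := by
    refine Real.le_sqrt_of_sq_le ?_
    rw [le_div_iff₀ hcB', mul_comm]
    exact hlam.trans (area_real_le_const _)
  have hlamL : √(area.real (E k)) ≤ L * t := by
    have h1 : area.real (E k) ≤ 300 * ballVolume * (cB * t) ^ 2 :=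
      (measureReal_mono fun x hx => Metric.mem_closedBall.2 (hdiam x hx)).trans
        (area_closedBall_le (ξ k) (by positivity))
    refine (Real.sqrt_le_sqrt h1).trans (le_of_eq ?_)
    rw [Real.sqrt_mul (by positivity), Real.sqrt_sq (by positivity)]
    ring
  have hlaml : √cB' * t ≤ √(area.real (E k)) := by
    refine le_trans (le_of_eq ?_) (Real.sqrt_le_sqrt hlam)
    rw [Real.sqrt_mul hcB'.le, Real.sqrt_sq ht.le]
  have hbound (x : S2) : |needlet B j s E ξ k x| ≤
      L * C * t * (t / max t (dist x (ξ k)) ^ 3) := by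
    have hm : 0 < max t (dist x (ξ k)) := lt_max_of_lt_left ht
    rw [needlet, abs_mul, abs_of_nonneg (Real.sqrt_nonneg _)]
    calc _ ≤ (L * t) * (C * (t / max t (dist x (ξ k)) ^ 3)) :=
          mul_le_mul hlamL (hup j htT x (ξ k)) (abs_nonneg _) (by positivity)
      _ = _ := by ring
  refine ⟨fun x => (hbound x).trans ?_, ?_, Metric.closedBall (ξ k) (ρ * t),
    Metric.isClosed_closedBall.measurableSet, ?_, fun x hx => ?_⟩
  · calc _ ≤ L * C * t * (t / t ^ 3) := by
          gcongr
          exact le_max_left _ _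
      _ = L * C / t := by field_simp
  · calc _ ≤ ∫⁻ x, ENNReal.ofReal (L * C * t) *
          ENNReal.ofReal (t / max t (dist x (ξ k)) ^ 3) ∂area := by
          refine lintegral_mono fun x => ?_
          rw [Real.enorm_eq_ofReal_abs, ← ENNReal.ofReal_mul (by positivity)]
          exact ENNReal.ofReal_le_ofReal (hbound x)
      _ ≤ ENNReal.ofReal (L * C * t) * ENNReal.ofReal (2400 * ballVolume) := by
          rw [lintegral_const_mul' _ _ ENNReal.ofReal_ne_top]
          gcongr
          exact lintegral_profile_le (ξ k) ht
      _ = _ := by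
          rw [← ENNReal.ofReal_mul (by positivity)]
          congr 1; ring
  · have h1 : ρ * t ≤ 1 := by
      calc ρ * t ≤ 1 / T * T := mul_le_mul (min_le_right _ _) htT ht.le (by positivity)
        _ = 1 := by field_simp
    refine le_trans (le_of_eq ?_) (le_area_closedBall (ξ k) (by positivity) h1)
    ring
  · have h1 : dist x (ξ k) ≤ δ * t :=
      (Metric.mem_closedBall.1 hx).trans (by gcongr; exact min_le_left _ _)
    have h2 := hlow j htT x (ξ k) h1
    rw [needlet]
    calc √cB' * c / t = (√cB' * t) * (c / t ^ 2) := by field_simp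
      _ ≤ _ := mul_le_mul hlaml h2 (by positivity) (Real.sqrt_nonneg _)

theorem continuous_needlet {B : ℝ} (hB : 0 < B) (j : ℤ) (s : ℕ) {N : ℕ} (E : Fin N → Set S2)
    (ξ : Fin N → S2) (k : Fin N) : Continuous (needlet B j s E ξ k) :=
  continuous_const.mul (continuous_kernel hB j s (ξ k))

end MexicanNeedlet

end

theorem mainTheorem2 (B : ℝ) (hB : 1 < B) (s : ℕ)
    (cB cB' : ℝ) (hcB : 0 < cB) (hcB' : 0 < cB') :
    (∀ (j : ℤ) (x y : MexicanNeedlet.S2), Summable (MexicanNeedlet.kernelTerm B j s x y)) ∧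
    (∀ p : ℝ, 1 ≤ p → ∃ c C : ℝ, 0 < c ∧ 0 < C ∧
      ∀ (j : ℤ) (N : ℕ) (E : Fin N → Set MexicanNeedlet.S2) (ξ : Fin N → MexicanNeedlet.S2),
        MexicanNeedlet.IsPartition B cB cB' j E ξ → ∀ k : Fin N,
          MemLp (MexicanNeedlet.needlet B j s E ξ k) (ENNReal.ofReal p) MexicanNeedlet.area ∧
          ENNReal.ofReal (c * B ^ (2 * (j : ℝ) * (1 / 2 - 1 / p))) ≤
            eLpNorm (MexicanNeedlet.needlet B j s E ξ k) (ENNReal.ofReal p) MexicanNeedlet.area ∧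
          eLpNorm (MexicanNeedlet.needlet B j s E ξ k) (ENNReal.ofReal p) MexicanNeedlet.area ≤
            ENNReal.ofReal (C * B ^ (2 * (j : ℝ) * (1 / 2 - 1 / p)))) ∧
    (∃ c C : ℝ, 0 < c ∧ 0 < C ∧
      ∀ (j : ℤ) (N : ℕ) (E : Fin N → Set MexicanNeedlet.S2) (ξ : Fin N → MexicanNeedlet.S2),
        MexicanNeedlet.IsPartition B cB cB' j E ξ → ∀ k : Fin N,
          MemLp (MexicanNeedlet.needlet B j s E ξ k) ∞ MexicanNeedlet.area ∧
          ENNReal.ofReal (c * B ^ j) ≤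
            eLpNorm (MexicanNeedlet.needlet B j s E ξ k) ∞ MexicanNeedlet.area ∧
          eLpNorm (MexicanNeedlet.needlet B j s E ξ k) ∞ MexicanNeedlet.area ≤
            ENNReal.ofReal (C * B ^ j)) := by
  have hB0 : 0 < B := by linarith
  obtain ⟨A, D, a, b, hA, hD, ha, hb, h⟩ :=
    MexicanNeedlet.exists_needlet_bounds hB0 s hcB hcB'
  refine ⟨fun j x y => MexicanNeedlet.summable_kernelTerm hB0 j s x y, fun p hp => ?_, ?_⟩
  · have hp0 : 0 < p := by linarith
    refine ⟨a * b ^ (1 / p), (A ^ (p - 1) * D) ^ (1 / p), by positivity, by positivity,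
      fun j N E ξ hE k => ?_⟩
    obtain ⟨h1, h2, S, hS, hbS, h3⟩ := h j N E ξ hE k
    have ht : 0 < B ^ (-j) := zpow_pos hB0 _
    have hexp : (B ^ (-j)) ^ (2 / p - 1) = B ^ (2 * (j : ℝ) * (1 / 2 - 1 / p)) := by
      rw [← Real.rpow_intCast, ← Real.rpow_mul hB0.le]
      congr 1
      push_cast
      ring
    have hle := MexicanNeedlet.eLpNorm_le_of_bound hA hD ht hp h1 h2
    have hge := MexicanNeedlet.le_eLpNorm_of_bound (p := ENNReal.ofReal p) ha hb ht
      (by simpa using hp0) hS hbS h3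
    rw [ENNReal.toReal_ofReal hp0.le, hexp] at hge
    rw [hexp] at hle
    exact ⟨⟨(MexicanNeedlet.continuous_needlet hB0 j s E ξ k).aestronglyMeasurable,
      hle.trans_lt ENNReal.ofReal_lt_top⟩, hge, hle⟩
  · refine ⟨a, A, ha, hA, fun j N E ξ hE k => ?_⟩
    obtain ⟨h1, h2, S, hS, hbS, h3⟩ := h j N E ξ hE k
    have ht : 0 < B ^ (-j) := zpow_pos hB0 _
    have hexp : (B ^ (-j)) ^ (-1 : ℝ) = B ^ j := by
      rw [Real.rpow_neg_one, zpow_neg, inv_inv]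
    have hle : eLpNorm (MexicanNeedlet.needlet B j s E ξ k) ∞ MexicanNeedlet.area ≤
        ENNReal.ofReal (A * B ^ j) := by
      have hAB : A / B ^ (-j) = A * B ^ j := by rw [zpow_neg, div_inv_eq_mul]
      rw [eLpNorm_exponent_top]
      refine eLpNormEssSup_le_of_ae_bound (Filter.Eventually.of_forall fun x => ?_)
      rw [← hAB]
      exact h1 x
    have hge := MexicanNeedlet.le_eLpNorm_of_bound (p := ∞) ha hb ht (by simp) hS hbS h3
    rw [ENNReal.toReal_top, div_zero, div_zero, Real.rpow_zero, mul_one, zero_sub, hexp] at hge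
    exact ⟨⟨(MexicanNeedlet.continuous_needlet hB0 j s E ξ k).aestronglyMeasurable,
      hle.trans_lt ENNReal.ofReal_lt_top⟩, hge, hle⟩
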